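/- Let $V$ be a finite-dimensional real vector space with a scalar product $\langle\cdot,\cdot\rangle$, let $\Gamma\subset V$ be a lattice spanning $V$, and let $X=[a_1,\dots,a_m]$ be a list of nonzero elements of $\Gamma$ spanning $V$. **Difference operators and function spaces.** For $a\in\Gamma$ and $f:\Gamma\to\mathbb Z$ put $(\nabla_a f)(\gamma)=f(\gamma)-f(\gamma-a)$, and $\nabla_Y=\prod_{a\in Y}\nabla_a$ for a list $Y$. A subspace $\underline r\subseteq V$ is *rational* if it is generated by a subset of the elements of $X$; let $S_X$ be the finite set of rational subspaces. Write $X\cap\underline r$ and $X\setminus\underline r$ for the sublists of elements of $X$ in, respectively not in, $\underline r$. Functions on $\Gamma\cap\underline r$ are regarded as functions on $\Gamma$ vanishing outside $\underline r$. Let $$\mathcal F(X)=\{f:\Gamma\to\mathbb Z \mid \nabla_{X\setminus\underline r}f\text{ is supported on }\Gamma\cap\underline r\text{ for all }\underline r\in S_X\},$$ and let $DM(X\cap\underline r)$ be the space of functions $q:\Gamma\cap\underline r\to\mathbb Z$ such that $\nabla_{(X\cap\underline r)\setminus\underline t}\,q=0$ for every proper subspace $\underline t\subsetneq\underline r$ generated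 by elements of $X\cap\underline r$. **Regular faces.** A vector $u\in\underline r^{\perp}$ is *regular* for $X\setminus\underline r$ if $\langle u,a\rangle\ne0$ for all $a\in X\setminus\underline r$; a *regular face* is a connected component of the set of regular vectors in $\underline r^\perp$. For a regular face $F$, let $A,B$ be the sublists of those elements of $X\setminus\underline r$ that are positive, respectively negative, on $F$, and let $\mathcal P_{X\setminus\underline r}^{F}:\Gamma\to\mathbb Z$ be defined by $$\sum_{\gamma\in\Gamma}\mathcal P_{X\setminus\underline r}^{F}(\gamma)e^\gamma=\prod_{a\in A}\Big(\sum_{k\ge0}e^{ka}\Big)\prod_{b\in B}\Big(-e^{-b}\sum_{k\ge0}e^{-kb}\Big).$$ **Topes and quasi-polynomials.** A *tope* for $X\cap\underline r$ is a connected component of the complement in $\underline r$ of the union of the hyperplanes of $\underline r$ generated by subsets of $X\cap\underline r$. The *zonotope* is $B(X\cap\underline r)=\{\sum_{a\in X\cap\underline r}t_a a\mid 0\le t_a\le1\}$. A *quasi-polynomial* on $\Gamma\cap\underline r$ is a function that coincides with a polynomial on each coset of some subgroup of finite index. For $g:\Gamma\cap\underline r\to\mathbb Z$ and a tope $\tau$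 for $X\cap\underline r$, let $g^\tau:\Gamma\cap\underline r\to\mathbb Z$ denote the quasi-polynomial coinciding with $g$ on $(\tau-B(X\cap\underline r))\cap\Gamma$, when there is exactly one. **Theorem.** Let $p_{\underline r}$ and $p_{\underline r^\perp}$ be the orthogonal projections onto $\underline r$ and $\underline r^\perp$. Let $\beta\in V$ be generic with respect to all rational subspaces, that is, for every $\underline r\in S_X$, $p_{\underline r}\beta$ lies in a tope $\tau(p_{\underline r}\beta)$ for $X\cap\underline r$ and $p_{\underline r^\perp}\beta$ is regular for $X\setminus\underline r$. Let $F^\beta_{\underline r}$ be the regular face for $X\setminus\underline r$ containing $p_{\underline r^\perp}\beta$. Then for every $f\in\mathcal F(X)$: 1. for every $\underline r\in S_X$ the quasi-polynomial $(\nabla_{X\setminus\underline r}f)^{\tau(p_{\underline r}\beta)}$ exists, is unique, and belongs to $DM(X\cap\underline r)$; 2. for every $\underline r\in S_X$ and $q\in DM(X\cap\underline r)$ the convolution $\mathcal P^{-F^\beta_{\underline r}}_{X\setminus\underline r}*q$ is well defined, each of its values being a sum with finitely many nonzero terms; 3. $$f=\sum_{\underline r\in S_X}\mathcal P_{X\setminus\underline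 r}^{-F^\beta_{\underline r}}*(\nabla_{X\setminus\underline r}f)^{\tau(p_{\underline r}\beta)};$$ 4. this is the only expression of $f$ as a sum $\sum_{\underline r\in S_X}\mathcal P_{X\setminus\underline r}^{-F^\beta_{\underline r}}*q_{\underline r}$ with $q_{\underline r}\in DM(X\cap\underline r)$ for all $\underline r\in S_X$. -/

import Mathlib

namespace LatticeSplines

variable {V : Type*} [NormedAddCommGroup V] [InnerProductSpace ℝ V]
  {Γ : Submodule ℤ V}

/-! ### Functions on a lattice `Γ ⊆ V`, difference operators, convolution -/

/-- The difference operator `(∇_a f)(γ) = f(γ) - f(γ - a)`. -/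
def nabla (a : Γ) (f : Γ → ℤ) : Γ → ℤ := fun γ => f γ - f (γ - a)

/-- `∇_L = ∏_{a ∈ L} ∇_a` for a list `L` (the operators commute). -/
def nablaList (L : List Γ) (f : Γ → ℤ) : Γ → ℤ := L.foldr nabla f

/-- The function `δ₀`, the unit for convolution. -/
noncomputable def delta0 : Γ → ℤ := by
  classical exact fun γ => if γ = 0 then 1 else 0

/-- The convolution `f₁ * f₂` is well defined: each of its values is a sum with only finitely
many nonzero terms. -/
def ConvDefined (f₁ f₂ : Γ → ℤ) : Prop :=
  ∀ γ : Γ, {μ : Γ | f₁ μ ≠ 0 ∧ f₂ (γ - μ) ≠ 0}.Finite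

/-- Convolution `(f₁ * f₂)(γ) = ∑_{μ ∈ Γ} f₁(μ) f₂(γ - μ)`
(meaningful when `ConvDefined f₁ f₂`). -/
noncomputable def conv (f₁ f₂ : Γ → ℤ) : Γ → ℤ := fun γ => ∑ᶠ μ : Γ, f₁ μ * f₂ (γ - μ)

/-- `f` is supported on `Γ ∩ W`. Such `f` are identified with the functions on `Γ ∩ W`. -/
def SupportedOn (W : Submodule ℝ V) (f : Γ → ℤ) : Prop := ∀ γ : Γ, (γ : V) ∉ W → f γ = 0

/-! ### Rational subspaces and sublists -/

/-- The sublist `X ∩ W` of the elements of `X` lying in `W`. -/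
noncomputable def inside (X : List Γ) (W : Submodule ℝ V) : List Γ := by
  classical exact X.filter (fun a => (a : V) ∈ W)

/-- The sublist `X \ W` of the elements of `X` not lying in `W`. -/
noncomputable def outside (X : List Γ) (W : Submodule ℝ V) : List Γ := by
  classical exact X.filter (fun a => (a : V) ∉ W)

/-- The set `S_X` of rational subspaces: those generated by a subset of the elements of `X`. -/
def rationalSubspaces (X : List Γ) : Set (Submodule ℝ V) :=
  (fun s : Set Γ => Submodule.span ℝ ((fun a : Γ => (a : V)) '' s)) '' 𝒫 {a | a ∈ X}

theorem finite_rationalSubspaces (X : List Γ) : (rationalSubspaces X).Finite :=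
  (List.finite_toSet X).powerset.image _

/-- `S_X` as a finite set. -/
noncomputable def rationalFinset (X : List Γ) : Finset (Submodule ℝ V) :=
  (finite_rationalSubspaces X).toFinset

/-! ### The spaces `DM(X)` and `F(X)` -/

/-- The Dahmen-Micchelli space `DM(L)` of a list `L` of elements of `Γ ∩ W` spanning `W`:
the functions on `Γ ∩ W` (extended by zero) with `∇_{L \ t} q = 0` for all proper rational
subspaces `t` of `W`. -/
def DM (L : List Γ) (W : Submodule ℝ V) : Set (Γ → ℤ) :=
  {q | SupportedOn W q ∧ ∀ t ∈ rationalSubspaces L, t ≠ W → nablaList (outside L t) q = 0}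

/-- The space `F(X)`: the functions `f` on `Γ` such that `∇_{X \ r} f` is supported on `r` for
every rational subspace `r`. -/
def FSpace (X : List Γ) : Set (Γ → ℤ) :=
  {f | ∀ r ∈ rationalSubspaces X, SupportedOn r (nablaList (outside X r) f)}

/-! ### Regular faces and the functions `P_{X \ r}^F` -/

/-- The regular vectors for `X \ r`: the `u ∈ rᗮ` with `⟨u, a⟩ ≠ 0` for all `a ∈ X \ r`. -/
def regularVectors (X : List Γ) (r : Submodule ℝ V) : Set V :=
  {u | u ∈ rᗮ ∧ ∀ a ∈ outside X r, inner ℝ u (a : V) ≠ 0}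

/-- The regular face for `X \ r` containing the regular vector `u`: the connected component of
`u` in the complement in `rᗮ` of the hyperplane arrangement given by `X \ r`. -/
def regularFace (X : List Γ) (r : Submodule ℝ V) (u : V) : Set V :=
  connectedComponentIn (regularVectors X r) u

open Classical in
/-- The coefficients of the expansion of `1 / (1 - e^a)` prescribed by the face `F`:
`∑_{k ≥ 0} e^{ka}` if `a` is positive on `F`, and `-e^{-a} ∑_{k ≥ 0} e^{-ka}` otherwise. -/
noncomputable def geomSeries (F : Set V) (a : Γ) : Γ → ℤ := fun γ =>
  if ∀ u ∈ F, 0 < inner ℝ u (a : V) then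
    (if ∃ k : ℕ, γ = k • a then 1 else 0)
  else
    (if ∃ k : ℕ, γ = -((k + 1) • a) then -1 else 0)

/-- The function `P_L^F` of coefficients of the product over `a ∈ L` of the series
`geomSeries F a`. -/
noncomputable def partitionFn (L : List Γ) (F : Set V) : Γ → ℤ :=
  (L.map (geomSeries F)).foldr conv delta0

/-! ### Topes, zonotopes, quasi-polynomials, and the functions `f^τ` -/

/-- The complement in `W` of the union of the hyperplanes of `W` generated by subsets of `L`. -/
def topeComplement (L : List Γ) (W : Submodule ℝ V) : Set V :=
  {x | x ∈ W ∧ ∀ t ∈ rationalSubspaces L, t ≤ W →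
    Module.finrank ℝ t + 1 = Module.finrank ℝ W → x ∉ t}

/-- `τ` is a tope for the list `L` of vectors spanning `W`: a connected component of
`topeComplement L W`. -/
def IsTope (L : List Γ) (W : Submodule ℝ V) (τ : Set V) : Prop :=
  ∃ x ∈ topeComplement L W, τ = connectedComponentIn (topeComplement L W) x

/-- The tope containing `x` (when `x` lies in some tope). -/
def topeAt (L : List Γ) (W : Submodule ℝ V) (x : V) : Set V :=
  connectedComponentIn (topeComplement L W) x

/-- The zonotope `B(L) = {∑ tᵢ aᵢ, 0 ≤ tᵢ ≤ 1}`. -/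
def zonotope (L : List Γ) : Set V :=
  {v | ∃ t : Fin L.length → ℝ, (∀ i, 0 ≤ t i ∧ t i ≤ 1) ∧
    v = ∑ i : Fin L.length, t i • ((L.get i : Γ) : V)}

variable (V) in
/-- The algebra of real polynomial functions on `V`, generated by the linear forms. -/
def polynomialFunctions : Subalgebra ℝ (V → ℝ) :=
  Algebra.adjoin ℝ (Set.range (fun φ : Module.Dual ℝ V => (φ : V → ℝ)))

/-- The lattice `Γ ∩ W`, as a subgroup of `Γ`. -/
def latticeIn (Γ : Submodule ℤ V) (W : Submodule ℝ V) : AddSubgroup Γ :=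
  W.toAddSubgroup.comap Γ.toAddSubgroup.subtype

/-- `q` is a quasi-polynomial on the lattice `Γ ∩ W` (extended by zero to `Γ`): it coincides
with a polynomial on each coset of some subgroup of finite index of `Γ ∩ W`. -/
def IsQuasiPolynomial (W : Submodule ℝ V) (q : Γ → ℤ) : Prop :=
  SupportedOn W q ∧
    ∃ Λ : AddSubgroup Γ, Λ ≤ latticeIn Γ W ∧ Λ.relIndex (latticeIn Γ W) ≠ 0 ∧
      ∀ γ ∈ latticeIn Γ W, ∃ p ∈ polynomialFunctions V,
        ∀ μ ∈ Λ, (q (γ + μ) : ℝ) = p ((γ + μ : Γ) : V)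

/-- `q` is a quasi-polynomial on `Γ ∩ W` coinciding with `g` on `(τ - B(L)) ∩ Γ`. -/
def IsTopeQuasiPolynomial (L : List Γ) (W : Submodule ℝ V) (g : Γ → ℤ) (τ : Set V)
    (q : Γ → ℤ) : Prop :=
  IsQuasiPolynomial W q ∧
    ∀ γ : Γ, (∃ x ∈ τ, ∃ b ∈ zonotope L, (γ : V) = x - b) → q γ = g γ

/-- The function `g^τ`: the quasi-polynomial on `Γ ∩ W` coinciding with `g` on `τ - B(L)`
(meaningful when there is exactly one). -/
noncomputable def topeQuasiPolynomial (L : List Γ) (W : Submodule ℝ V) (g : Γ → ℤ)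
    (τ : Set V) : Γ → ℤ :=
  Classical.epsilon (IsTopeQuasiPolynomial L W g τ)

/-! ### Generic points -/

/-- `β` is generic with respect to `r`: its orthogonal projection to `r` lies in a tope for
`X ∩ r`, and its orthogonal projection to `rᗮ` is regular for `X \ r`. -/
def IsGeneric [FiniteDimensional ℝ V] (X : List Γ) (r : Submodule ℝ V) (β : V) : Prop :=
  (∃ τ, IsTope (inside X r) r τ ∧ r.starProjection β ∈ τ) ∧
    rᗮ.starProjection β ∈ regularVectors X r

open scoped Pointwise in
/-- The function `P_{X \ r}^{-F}`, where `F` is the regular face for `X \ r` containing the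
orthogonal projection of `β` to `rᗮ`. -/
noncomputable def negPartitionFn [FiniteDimensional ℝ V] (X : List Γ) (r : Submodule ℝ V)
    (β : V) : Γ → ℤ :=
  partitionFn (outside X r) (-(regularFace X r (rᗮ.starProjection β)))

/-- The function `(∇_{X \ r} f)^{τ(p_r β)}`, where `τ(p_r β)` is the tope for `X ∩ r` containing
the orthogonal projection `p_r β` of `β` to `r`. -/
noncomputable def localQuasiPolynomial [FiniteDimensional ℝ V] (X : List Γ)
    (r : Submodule ℝ V) (β : V) (f : Γ → ℤ) : Γ → ℤ :=
  topeQuasiPolynomial (inside X r) r (nablaList (outside X r) f)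
    (topeAt (inside X r) r (r.starProjection β))

end LatticeSplines

open LatticeSplines

set_option linter.unusedSectionVars false

namespace LatticeSplines

variable {V : Type*} [NormedAddCommGroup V] [InnerProductSpace ℝ V]
  {Γ : Submodule ℤ V}

/-! ### The group ring acting on functions by translations -/

/-- Translation of functions by `a`. -/
def translate (a : Γ) : Module.End ℤ (Γ → ℤ) where
  toFun f γ := f (γ - a)
  map_add' _ _ := rfl
  map_smul' _ _ := rfl

variable (Γ) in
/-- The group ring of `Γ` acts on functions on `Γ` by translations. -/
noncomputable def groupRingAction : AddMonoidAlgebra ℤ Γ →ₐ[ℤ] Module.End ℤ (Γ → ℤ) :=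
  AddMonoidAlgebra.lift ℤ _ Γ
    { toFun := fun a => translate a.toAdd
      map_one' := by ext f γ; simp [translate]
      map_mul' := fun a b => by
        ext f γ
        simp [translate, sub_sub] }

/-- The element `1 - e^a` of the group ring. -/
noncomputable def oneSubExp (a : Γ) : AddMonoidAlgebra ℤ Γ := 1 - AddMonoidAlgebra.single a 1

theorem groupRingAction_oneSubExp (a : Γ) (f : Γ → ℤ) :
    groupRingAction Γ (oneSubExp a) f = nabla a f := by
  ext γ
  simp [groupRingAction, oneSubExp, nabla, translate]

theorem nablaList_eq_groupRingAction (L : List Γ) (f : Γ → ℤ) :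
    nablaList L f = groupRingAction Γ (L.map oneSubExp).prod f := by
  induction L with
  | nil => simp [nablaList]
  | cons a L ih =>
    have : nablaList (a :: L) f = nabla a (nablaList L f) := rfl
    rw [this, ih, List.map_cons, List.prod_cons, map_mul, Module.End.mul_apply,
      groupRingAction_oneSubExp]

theorem nablaList_append (L M : List Γ) (f : Γ → ℤ) :
    nablaList (L ++ M) f = nablaList L (nablaList M f) := by
  simp [nablaList]

theorem nablaList_perm {L M : List Γ} (h : L.Perm M) (f : Γ → ℤ) :
    nablaList L f = nablaList M f := by
  rw [nablaList_eq_groupRingAction, nablaList_eq_groupRingAction, (h.map _).prod_eq]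

theorem nablaList_comm (L M : List Γ) (f : Γ → ℤ) :
    nablaList L (nablaList M f) = nablaList M (nablaList L f) := by
  rw [← nablaList_append, ← nablaList_append, nablaList_perm List.perm_append_comm]

theorem nablaList_add (L : List Γ) (f g : Γ → ℤ) :
    nablaList L (f + g) = nablaList L f + nablaList L g := by
  simp [nablaList_eq_groupRingAction]

theorem nablaList_sub (L : List Γ) (f g : Γ → ℤ) :
    nablaList L (f - g) = nablaList L f - nablaList L g := by
  simp [nablaList_eq_groupRingAction]

theorem nablaList_zero (L : List Γ) : nablaList L (0 : Γ → ℤ) = 0 := by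
  simp [nablaList_eq_groupRingAction]

theorem nablaList_sum {ι : Type*} (L : List Γ) (s : Finset ι) (f : ι → Γ → ℤ) :
    nablaList L (∑ i ∈ s, f i) = ∑ i ∈ s, nablaList L (f i) := by
  simp [nablaList_eq_groupRingAction]

/-! ### Sublists and rational subspaces -/

theorem mem_inside {X : List Γ} {W : Submodule ℝ V} {a : Γ} :
    a ∈ inside X W ↔ a ∈ X ∧ (a : V) ∈ W := by
  simp [inside]

theorem mem_outside {X : List Γ} {W : Submodule ℝ V} {a : Γ} :
    a ∈ outside X W ↔ a ∈ X ∧ (a : V) ∉ W := by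
  simp [outside]

theorem outside_perm_of_le (X : List Γ) {t r : Submodule ℝ V} (h : t ≤ r) :
    (outside X t).Perm (outside (inside X r) t ++ outside X r) := by
  classical
  have h1 := List.filter_append_perm (fun a : Γ => decide ((a : V) ∈ r)) (outside X t)
  refine h1.symm.trans (List.Perm.of_eq ?_)
  unfold outside inside
  simp only [List.filter_filter]
  congr 1
  · exact List.filter_congr fun a _ => by simp [Bool.and_comm]
  · refine List.filter_congr fun a _ => ?_
    by_cases ha : (a : V) ∈ r
    · simp [ha]
    · have : (a : V) ∉ t := fun h' => ha (h h')
      simp [ha, this]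

/-- The rational subspace generated by the elements of `X` in `W`. -/
def spanInside (X : List Γ) (W : Submodule ℝ V) : Submodule ℝ V :=
  Submodule.span ℝ ((fun a : Γ => (a : V)) '' {a | a ∈ X ∧ (a : V) ∈ W})

theorem spanInside_mem (X : List Γ) (W : Submodule ℝ V) : spanInside X W ∈ rationalSubspaces X :=
  ⟨_, fun _ h => h.1, rfl⟩

theorem spanInside_le (X : List Γ) (W : Submodule ℝ V) : spanInside X W ≤ W := by
  rw [spanInside, Submodule.span_le]
  rintro _ ⟨a, ha, rfl⟩
  exact ha.2

theorem mem_spanInside {X : List Γ} {W : Submodule ℝ V} {a : Γ} (ha : a ∈ X) :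
    (a : V) ∈ spanInside X W ↔ (a : V) ∈ W :=
  ⟨fun h => spanInside_le X W h, fun h => Submodule.subset_span ⟨a, ⟨ha, h⟩, rfl⟩⟩

theorem spanInside_of_mem {X : List Γ} {W : Submodule ℝ V} (h : W ∈ rationalSubspaces X) :
    spanInside X W = W := by
  refine le_antisymm (spanInside_le X W) ?_
  obtain ⟨s, hs, rfl⟩ := h
  rw [Submodule.span_le]
  rintro _ ⟨a, ha, rfl⟩
  exact Submodule.subset_span ⟨a, ⟨hs ha, Submodule.subset_span ⟨a, ha, rfl⟩⟩, rfl⟩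

theorem span_inside {X : List Γ} {W : Submodule ℝ V} (h : W ∈ rationalSubspaces X) :
    Submodule.span ℝ ((fun a : Γ => (a : V)) '' {a | a ∈ inside X W}) = W := by
  conv_rhs => rw [← spanInside_of_mem h]
  simp only [mem_inside, spanInside]

theorem mem_rationalSubspaces_inside {X : List Γ} {t r : Submodule ℝ V} :
    t ∈ rationalSubspaces (inside X r) ↔ t ∈ rationalSubspaces X ∧ t ≤ r := by
  constructor
  · rintro ⟨s, hs, rfl⟩
    refine ⟨⟨s, fun a ha => (mem_inside.1 (hs ha)).1, rfl⟩, Submodule.span_le.2 ?_⟩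
    rintro _ ⟨a, ha, rfl⟩
    exact (mem_inside.1 (hs ha)).2
  · rintro ⟨⟨s, hs, rfl⟩, h⟩
    exact ⟨s, fun a ha => mem_inside.2 ⟨hs ha, h (Submodule.subset_span ⟨a, ha, rfl⟩)⟩, rfl⟩

theorem outside_perm_spanInside (X : List Γ) (t r : Submodule ℝ V) :
    (outside X r).Perm
      (outside (outside X r) t ++ outside (inside X t) (spanInside (inside X t) r)) := by
  classical
  have h1 := List.filter_append_perm (fun a : Γ => decide ((a : V) ∉ t)) (outside X r)
  refine h1.symm.trans (List.Perm.of_eq ?_)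
  congr 1
  · have : outside (inside X t) (spanInside (inside X t) r) = outside (inside X t) r := by
      unfold outside
      refine List.filter_congr fun a ha => ?_
      have := mem_spanInside (W := r) ha
      rw [decide_eq_decide]
      exact not_congr this
    rw [this]
    unfold outside inside
    simp only [List.filter_filter]
    exact List.filter_congr fun a _ => by simp [Bool.and_comm]

theorem DM_nablaList_outside_eq_zero {X : List Γ} {t r : Submodule ℝ V} {q : Γ → ℤ}
    (hq : q ∈ DM (inside X t) t) (h : ¬ t ≤ r) : nablaList (outside X r) q = 0 := by
  rw [nablaList_perm (outside_perm_spanInside X t r), nablaList_append,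
    hq.2 _ (spanInside_mem _ _) (fun h' => h (h' ▸ spanInside_le _ _)), nablaList_zero]

theorem zero_mem_DM (L : List Γ) (W : Submodule ℝ V) : (0 : Γ → ℤ) ∈ DM L W :=
  ⟨fun _ _ => rfl, fun _ _ _ => nablaList_zero _⟩

theorem add_mem_DM {L : List Γ} {W : Submodule ℝ V} {p q : Γ → ℤ} (hp : p ∈ DM L W)
    (hq : q ∈ DM L W) : p + q ∈ DM L W := by
  refine ⟨fun γ h => by simp [hp.1 γ h, hq.1 γ h], fun t ht htW => ?_⟩
  rw [nablaList_add, hp.2 t ht htW, hq.2 t ht htW, add_zero]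

/-! ### Convolution -/

theorem exists_of_conv_ne_zero {f g : Γ → ℤ} {γ : Γ} (h : conv f g γ ≠ 0) :
    ∃ μ, f μ ≠ 0 ∧ g (γ - μ) ≠ 0 := by
  by_contra! H
  apply h
  unfold conv
  rw [finsum_eq_zero_of_forall_eq_zero]
  intro μ
  by_cases hμ : f μ = 0
  · simp [hμ]
  · simp [H μ hμ]

theorem delta0_conv (g : Γ → ℤ) : conv delta0 g = g := by
  funext γ
  unfold conv delta0
  rw [finsum_eq_single _ 0 (by intro x hx; simp [hx])]
  simp

theorem ConvDefined.support_finite {f g : Γ → ℤ} (h : ConvDefined f g) (γ : Γ) :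
    (Function.support fun μ => f μ * g (γ - μ)).Finite :=
  (h γ).subset fun μ hμ => by
    simpa [not_or] using hμ

theorem conv_add {f g₁ g₂ : Γ → ℤ} (h₁ : ConvDefined f g₁) (h₂ : ConvDefined f g₂) :
    conv f (g₁ + g₂) = conv f g₁ + conv f g₂ := by
  funext γ
  simp only [conv, Pi.add_apply, mul_add]
  exact finsum_add_distrib (h₁.support_finite γ) (h₂.support_finite γ)

theorem conv_zero (f : Γ → ℤ) : conv f 0 = 0 := by
  funext γ
  simp [conv]

theorem nabla_conv {f g : Γ → ℤ} (h : ConvDefined f g) (a : Γ) :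
    nabla a (conv f g) = conv (nabla a f) g := by
  funext γ
  have e : conv f g (γ - a) = ∑ᶠ ν : Γ, f (ν - a) * g (γ - ν) := by
    unfold conv
    rw [← finsum_comp_equiv (Equiv.subRight a)]
    refine finsum_congr fun ν => ?_
    simp only [Equiv.subRight_apply]
    congr 2
    abel
  have fin : (Function.support fun ν => f (ν - a) * g (γ - ν)).Finite := by
    refine ((h.support_finite (γ - a)).preimage ((Equiv.subRight a).injective.injOn)).subset ?_
    intro ν hν
    simp only [Set.mem_preimage, Equiv.subRight_apply, Function.mem_support] at hν ⊢
    convert hν using 3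
    abel
  rw [nabla, e, conv, conv, ← finsum_sub_distrib (h.support_finite γ) fin]
  refine finsum_congr fun μ => ?_
  simp [nabla, sub_mul]

/-! ### Supports of the partition functions -/

theorem coe_nsmul_real (k : ℕ) (a : Γ) : ((k • a : Γ) : V) = (k : ℝ) • (a : V) := by
  rw [Nat.cast_smul_eq_nsmul]; rfl

open Classical in
/-- The one of `a`, `-a` in whose direction `geomSeries F a` expands. -/
noncomputable def posDir (F : Set V) (a : Γ) : Γ :=
  if ∀ u ∈ F, 0 < inner ℝ u (a : V) then a else -a

/-- The vector `u` is positive on the directions of expansion for `L` and `F`. -/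
def IsPositiveFor (F : Set V) (u : V) (L : List Γ) : Prop :=
  ∀ a ∈ L, 0 < inner ℝ u (posDir F a : V)

theorem IsPositiveFor.mono {F : Set V} {u : V} {L M : List Γ} (h : IsPositiveFor F u L)
    (hML : ∀ a ∈ M, a ∈ L) : IsPositiveFor F u M := fun a ha => h a (hML a ha)

theorem posDir_eq_or (F : Set V) (a : Γ) : posDir F a = a ∨ posDir F a = -a := by
  unfold posDir
  split_ifs <;> simp

theorem IsPositiveFor.inner_ne_zero {F : Set V} {u : V} {L : List Γ} (h : IsPositiveFor F u L)
    {a : Γ} (ha : a ∈ L) : inner ℝ u (a : V) ≠ 0 := by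
  intro h0
  have := h a ha
  rcases posDir_eq_or F a with e | e <;> simp [e, h0] at this

theorem geomSeries_support_add {F : Set V} {a γ : Γ} (h : geomSeries F a γ ≠ 0) {t : ℝ}
    (h0 : 0 ≤ t) (h1 : t ≤ 1) :
    ∃ s : ℝ, 0 ≤ s ∧ (γ : V) + t • (a : V) = s • (posDir F a : V) := by
  unfold geomSeries at h
  unfold posDir
  split_ifs at h ⊢ with hF hk hk
  · obtain ⟨k, rfl⟩ := hk
    refine ⟨k + t, by positivity, ?_⟩
    rw [coe_nsmul_real, add_smul]
  · exact absurd rfl h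
  · obtain ⟨k, rfl⟩ := hk
    refine ⟨k + 1 - t, by have : (0 : ℝ) ≤ k := k.cast_nonneg; linarith, ?_⟩
    simp only [NegMemClass.coe_neg, coe_nsmul_real]
    push_cast
    module
  · exact absurd rfl h

theorem geomSeries_support {F : Set V} {a γ : Γ} (h : geomSeries F a γ ≠ 0) :
    ∃ k : ℕ, γ = k • posDir F a := by
  unfold geomSeries at h
  unfold posDir
  split_ifs at h ⊢ with hF hk hk
  · exact hk
  · exact absurd rfl h
  · obtain ⟨k, rfl⟩ := hk
    exact ⟨k + 1, by simp⟩
  · exact absurd rfl h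

theorem nabla_geomSeries (F : Set V) {a : Γ} (ha : a ≠ 0) :
    nabla a (geomSeries F a) = delta0 := by
  have haV : (a : V) ≠ 0 := fun h => ha (Subtype.ext h)
  have inj : ∀ k : ℕ, k • a = 0 → k = 0 := by
    intro k hk
    have : ((k • a : Γ) : V) = 0 := by rw [hk]; rfl
    rw [coe_nsmul_real] at this
    simpa [haV] using this
  funext γ
  unfold nabla geomSeries delta0
  by_cases hF : ∀ u ∈ F, 0 < inner ℝ u (a : V)
  · simp only [if_pos hF]
    by_cases h0 : γ = 0
    · subst h0
      have h1 : ∃ k : ℕ, (0 : Γ) = k • a := ⟨0, by simp⟩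
      have h2 : ¬ ∃ k : ℕ, (0 : Γ) - a = k • a := by
        rintro ⟨k, hk⟩
        have := inj (k + 1) (by rw [succ_nsmul, ← hk]; abel)
        omega
      simp only [if_pos h1, if_neg h2]
      simp
    · have : (∃ k : ℕ, γ = k • a) ↔ ∃ k : ℕ, γ - a = k • a := by
        constructor
        · rintro ⟨k, rfl⟩
          cases k with
          | zero => simp at h0
          | succ k => exact ⟨k, by rw [succ_nsmul]; abel⟩
        · rintro ⟨k, hk⟩
          exact ⟨k + 1, by rw [succ_nsmul, ← hk]; abel⟩
      by_cases hk : ∃ k : ℕ, γ = k • a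
      · rw [if_pos hk, if_pos (this.1 hk), if_neg h0, sub_self]
      · rw [if_neg hk, if_neg (fun h => hk (this.2 h)), if_neg h0, sub_self]
  · simp only [if_neg hF]
    by_cases h0 : γ = 0
    · subst h0
      have h1 : ¬ ∃ k : ℕ, (0 : Γ) = -((k + 1) • a) := by
        rintro ⟨k, hk⟩
        have := inj (k + 1) (by rw [← neg_eq_zero, ← hk])
        omega
      have h2 : ∃ k : ℕ, (0 : Γ) - a = -((k + 1) • a) := ⟨0, by simp⟩
      simp only [if_pos h2, if_neg h1]
      simp
    · have : (∃ k : ℕ, γ = -((k + 1) • a)) ↔ ∃ k : ℕ, γ - a = -((k + 1) • a) := by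
        constructor
        · rintro ⟨k, rfl⟩
          exact ⟨k + 1, by rw [succ_nsmul a (k + 1)]; abel⟩
        · rintro ⟨k, hk⟩
          cases k with
          | zero => simp at hk; exact absurd hk h0
          | succ k =>
            refine ⟨k, ?_⟩
            rw [succ_nsmul a (k + 1)] at hk
            have := congrArg (· + a) hk
            simpa using this
      by_cases hk : ∃ k : ℕ, γ = -((k + 1) • a)
      · rw [if_pos hk, if_pos (this.1 hk), if_neg h0, sub_self]
      · rw [if_neg hk, if_neg (fun h => hk (this.2 h)), if_neg h0, sub_self]

theorem partitionFn_cons (a : Γ) (L : List Γ) (F : Set V) :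
    partitionFn (a :: L) F = conv (geomSeries F a) (partitionFn L F) := rfl

theorem partitionFn_nil (F : Set V) : partitionFn ([] : List Γ) F = delta0 := rfl

theorem eq_zero_of_delta0_ne_zero {γ : Γ} (h : (delta0 γ : ℤ) ≠ 0) : γ = 0 := by
  by_contra h'
  simp [delta0, h'] at h

theorem inner_nsmul_add (u : V) (k : ℕ) (a ν : Γ) :
    inner ℝ u ((k • a + ν : Γ) : V) = k * inner ℝ u (a : V) + inner ℝ u (ν : V) := by
  rw [Submodule.coe_add, coe_nsmul_real, inner_add_right, inner_smul_right]

theorem exists_of_partitionFn_cons_ne_zero {a : Γ} {L : List Γ} {F : Set V} {γ : Γ}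
    (h : partitionFn (a :: L) F γ ≠ 0) :
    ∃ (k : ℕ) (ν : Γ), γ = k • posDir F a + ν ∧ partitionFn L F ν ≠ 0 := by
  rw [partitionFn_cons] at h
  obtain ⟨μ, h1, h2⟩ := exists_of_conv_ne_zero h
  obtain ⟨k, rfl⟩ := geomSeries_support h1
  exact ⟨k, _, by abel, h2⟩

theorem partitionFn_nonneg {F : Set V} {u : V} {L : List Γ} (hu : IsPositiveFor F u L) {γ : Γ}
    (h : partitionFn L F γ ≠ 0) : 0 ≤ inner ℝ u (γ : V) := by
  induction L generalizing γ with
  | nil =>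
    rw [partitionFn_nil] at h
    rw [eq_zero_of_delta0_ne_zero h]
    simp
  | cons a L ih =>
    obtain ⟨k, ν, rfl, hν⟩ := exists_of_partitionFn_cons_ne_zero h
    rw [inner_nsmul_add]
    have h1 := hu a (by simp)
    have h2 := ih (hu.mono (by simp +contextual)) hν
    positivity

theorem partitionFn_finite {F : Set V} {u : V} {L : List Γ} (hu : IsPositiveFor F u L) (C : ℝ) :
    {γ : Γ | partitionFn L F γ ≠ 0 ∧ inner ℝ u (γ : V) ≤ C}.Finite := by
  induction L with
  | nil =>
    refine (Set.finite_singleton (0 : Γ)).subset ?_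
    rintro γ ⟨h, -⟩
    exact eq_zero_of_delta0_ne_zero h
  | cons a L ih =>
    have hL : IsPositiveFor F u L := hu.mono (by simp +contextual)
    have ha := hu a (by simp)
    obtain ⟨N, hN⟩ := exists_nat_gt (C / inner ℝ u (posDir F a : V))
    refine (((Set.finite_Iio N).prod (ih hL)).image
      (fun p : ℕ × Γ => p.1 • posDir F a + p.2)).subset ?_
    rintro γ ⟨h, hC⟩
    obtain ⟨k, ν, rfl, hν⟩ := exists_of_partitionFn_cons_ne_zero h
    rw [inner_nsmul_add] at hC
    have h2 := partitionFn_nonneg hL hν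
    refine ⟨(k, ν), ⟨?_, hν, ?_⟩, rfl⟩
    · have h3 : (k : ℝ) ≤ C / inner ℝ u (posDir F a : V) := by
        rw [le_div_iff₀ ha]; linarith
      exact_mod_cast h3.trans_lt hN
    · have : 0 ≤ (k : ℝ) * inner ℝ u (posDir F a : V) := by positivity
      linarith

theorem convDefined_geomSeries {F : Set V} {u : V} {a : Γ} {L : List Γ}
    (hu : IsPositiveFor F u (a :: L)) : ConvDefined (geomSeries F a) (partitionFn L F) := by
  intro γ
  have ha := hu a (by simp)
  obtain ⟨N, hN⟩ := exists_nat_gt (inner ℝ u (γ : V) / inner ℝ u (posDir F a : V))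
  refine ((Set.finite_Iio N).image fun k : ℕ => k • posDir F a).subset ?_
  rintro μ ⟨h1, h2⟩
  obtain ⟨k, rfl⟩ := geomSeries_support h1
  have h3 := partitionFn_nonneg (hu.mono (by simp +contextual)) h2
  refine ⟨k, ?_, rfl⟩
  rw [Submodule.coe_sub, coe_nsmul_real, inner_sub_right, inner_smul_right] at h3
  have h4 : (k : ℝ) ≤ inner ℝ u (γ : V) / inner ℝ u (posDir F a : V) := by
    rw [le_div_iff₀ ha]; linarith
  exact_mod_cast h4.trans_lt hN

theorem convDefined_partitionFn {F : Set V} {u : V} {L : List Γ} (hu : IsPositiveFor F u L)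
    {r : Submodule ℝ V} (hur : u ∈ rᗮ) {q : Γ → ℤ} (hq : SupportedOn r q) :
    ConvDefined (partitionFn L F) q := by
  intro γ
  refine (partitionFn_finite hu (inner ℝ u (γ : V))).subset ?_
  rintro μ ⟨h1, h2⟩
  refine ⟨h1, ?_⟩
  have h3 : ((γ - μ : Γ) : V) ∈ r := by
    by_contra h
    exact h2 (hq _ h)
  have h4 := (Submodule.mem_orthogonal' r u).1 hur _ h3
  rw [Submodule.coe_sub, inner_sub_right] at h4
  linarith

theorem nablaList_conv_partitionFn {F : Set V} {u : V} {L : List Γ} (hu : IsPositiveFor F u L)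
    {r : Submodule ℝ V} (hur : u ∈ rᗮ) {q : Γ → ℤ} (hq : SupportedOn r q) :
    nablaList L (conv (partitionFn L F) q) = q := by
  induction L with
  | nil => exact delta0_conv q
  | cons a L ih =>
    have ha : a ≠ 0 := by
      rintro rfl
      exact hu.inner_ne_zero (a := 0) (by simp) (by simp)
    have e : nablaList (a :: L) (conv (partitionFn (a :: L) F) q)
        = nablaList L (nablaList [a] (conv (partitionFn (a :: L) F) q)) := by
      rw [nablaList_comm L [a]]; rfl
    rw [e]
    change nablaList L (nabla a (conv (partitionFn (a :: L) F) q)) = q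
    rw [nabla_conv (convDefined_partitionFn hu hur hq), partitionFn_cons,
      nabla_conv (convDefined_geomSeries hu), nabla_geomSeries F ha, delta0_conv]
    exact ih (hu.mono (by simp +contextual))

/-! ### Functions supported in a half space -/

/-- The function `h` is supported in a half space `⟨u, ·⟩ ≥ C`. -/
def HalfSpaceSupported (u : V) (h : Γ → ℤ) : Prop :=
  ∃ C : ℝ, ∀ γ, h γ ≠ 0 → C ≤ inner ℝ u (γ : V)

theorem HalfSpaceSupported.sub {u : V} {f g : Γ → ℤ} (hf : HalfSpaceSupported u f)
    (hg : HalfSpaceSupported u g) : HalfSpaceSupported u (f - g) := by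
  obtain ⟨C, hC⟩ := hf
  obtain ⟨D, hD⟩ := hg
  refine ⟨min C D, fun γ h => ?_⟩
  by_cases h1 : f γ = 0
  · exact (min_le_right _ _).trans (hD γ fun h2 => h (by simp [h1, h2]))
  · exact (min_le_left _ _).trans (hC γ h1)

theorem HalfSpaceSupported.nabla {u : V} {f : Γ → ℤ} (hf : HalfSpaceSupported u f) (a : Γ) :
    HalfSpaceSupported u (nabla a f) := by
  refine hf.sub ?_
  obtain ⟨C, hC⟩ := hf
  refine ⟨C + inner ℝ u (a : V), fun γ h => ?_⟩
  have := hC _ h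
  rw [Submodule.coe_sub, inner_sub_right] at this
  linarith

theorem HalfSpaceSupported.nablaList {u : V} {f : Γ → ℤ} (hf : HalfSpaceSupported u f)
    (L : List Γ) : HalfSpaceSupported u (nablaList L f) := by
  induction L with
  | nil => exact hf
  | cons a L ih => exact ih.nabla a

theorem HalfSpaceSupported.eq_zero_of_nabla {u : V} {f : Γ → ℤ} (hf : HalfSpaceSupported u f)
    {a : Γ} (ha : inner ℝ u (a : V) ≠ 0) (h : LatticeSplines.nabla a f = 0) : f = 0 := by
  obtain ⟨C, hC⟩ := hf
  have per : Function.Periodic f a := fun γ => by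
    have := congrFun h (γ + a)
    simp only [LatticeSplines.nabla, add_sub_cancel_right, Pi.zero_apply] at this
    linarith
  funext γ
  by_contra hγ
  have key : ∃ n : ℤ, inner ℝ u ((n • a : Γ) : V) < C - inner ℝ u (γ : V) := by
    have hn : ∀ n : ℤ, inner ℝ u ((n • a : Γ) : V) = n * inner ℝ u (a : V) := fun n => by
      have : ((n • a : Γ) : V) = (n : ℝ) • (a : V) := by
        rw [Int.cast_smul_eq_zsmul]; rfl
      rw [this, inner_smul_right]
    simp only [hn]
    rcases lt_or_gt_of_ne ha with h' | h'
    · obtain ⟨n, hn⟩ := exists_int_gt ((C - inner ℝ u (γ : V)) / inner ℝ u (a : V))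
      exact ⟨n, by rwa [div_lt_iff_of_neg h'] at hn⟩
    · obtain ⟨n, hn⟩ := exists_int_lt ((C - inner ℝ u (γ : V)) / inner ℝ u (a : V))
      exact ⟨n, by rwa [lt_div_iff₀ h'] at hn⟩
  obtain ⟨n, hn⟩ := key
  have h1 : f (γ + n • a) ≠ 0 := by rw [per.zsmul n γ]; exact hγ
  have h2 := hC _ h1
  rw [Submodule.coe_add, inner_add_right] at h2
  linarith

theorem HalfSpaceSupported.eq_zero_of_nablaList {u : V} {f : Γ → ℤ}
    (hf : HalfSpaceSupported u f) {L : List Γ} (hL : ∀ a ∈ L, inner ℝ u (a : V) ≠ 0)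
    (h : LatticeSplines.nablaList L f = 0) : f = 0 := by
  induction L with
  | nil => exact h
  | cons a L ih =>
    exact ih (fun b hb => hL b (by simp [hb]))
      ((hf.nablaList L).eq_zero_of_nabla (hL a (by simp)) h)

theorem halfSpaceSupported_conv {F : Set V} {u : V} {L : List Γ} (hu : IsPositiveFor F u L)
    {r : Submodule ℝ V} (hur : u ∈ rᗮ) {q : Γ → ℤ} (hq : SupportedOn r q) :
    HalfSpaceSupported u (conv (partitionFn L F) q) := by
  refine ⟨0, fun γ h => ?_⟩
  obtain ⟨μ, h1, h2⟩ := exists_of_conv_ne_zero h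
  have h3 : ((γ - μ : Γ) : V) ∈ r := by
    by_contra h
    exact h2 (hq _ h)
  have h4 := (Submodule.mem_orthogonal' r u).1 hur _ h3
  rw [Submodule.coe_sub, inner_sub_right] at h4
  have := partitionFn_nonneg hu h1
  linarith

theorem nablaList_conv_of_not_le {X : List Γ} {F : Set V} {u : V} {t r : Submodule ℝ V}
    (hu : IsPositiveFor F u (outside X t)) (hut : u ∈ tᗮ) {q : Γ → ℤ}
    (hq : q ∈ DM (inside X t) t) (h : ¬ t ≤ r) :
    nablaList (outside X r) (conv (partitionFn (outside X t) F) q) = 0 := by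
  refine ((halfSpaceSupported_conv hu hut hq.1).nablaList _).eq_zero_of_nablaList
    (fun a ha => hu.inner_ne_zero ha) ?_
  rw [nablaList_comm, nablaList_conv_partitionFn hu hut hq.1, DM_nablaList_outside_eq_zero hq h]

theorem nablaList_conv_of_le {X : List Γ} {F : Set V} {u : V} {t r : Submodule ℝ V}
    (hu : IsPositiveFor F u (outside X t)) (hut : u ∈ tᗮ) {q : Γ → ℤ}
    (hq : SupportedOn t q) (h : t ≤ r) :
    nablaList (outside X r) (conv (partitionFn (outside X t) F) q)
      = conv (partitionFn (outside (inside X r) t) F) q := by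
  have hu' : IsPositiveFor F u (outside (inside X r) t) := hu.mono fun a ha => by
    rw [mem_outside, mem_inside] at ha
    exact mem_outside.2 ⟨ha.1.1, ha.2⟩
  rw [← sub_eq_zero]
  refine (((halfSpaceSupported_conv hu hut hq).nablaList _).sub
    (halfSpaceSupported_conv hu' hut hq)).eq_zero_of_nablaList
    (fun a ha => hu'.inner_ne_zero ha) ?_
  rw [nablaList_sub, ← nablaList_append, ← nablaList_perm (outside_perm_of_le X h),
    nablaList_conv_partitionFn hu hut hq, nablaList_conv_partitionFn hu' hut hq, sub_self]

theorem supportedOn_conv_partitionFn {F : Set V} {L : List Γ} {t r : Submodule ℝ V}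
    (hL : ∀ a ∈ L, (a : V) ∈ r) {q : Γ → ℤ} (hq : SupportedOn t q) (h : t ≤ r) :
    SupportedOn r (conv (partitionFn L F) q) := by
  have key : ∀ μ, partitionFn L F μ ≠ 0 → (μ : V) ∈ r := by
    induction L with
    | nil =>
      intro μ hμ
      rw [eq_zero_of_delta0_ne_zero hμ]
      simp
    | cons a L ih =>
      intro μ hμ
      obtain ⟨k, ν, rfl, hν⟩ := exists_of_partitionFn_cons_ne_zero hμ
      rw [Submodule.coe_add, coe_nsmul_real]
      refine r.add_mem (r.smul_mem _ ?_) (ih (fun b hb => hL b (by simp [hb])) ν hν)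
      rcases posDir_eq_or F a with e | e
      · rw [e]; exact hL a (by simp)
      · rw [e]; exact r.neg_mem (hL a (by simp))
  intro γ hγ
  by_contra h0
  obtain ⟨μ, h1, h2⟩ := exists_of_conv_ne_zero h0
  have h3 : ((γ - μ : Γ) : V) ∈ t := by
    by_contra h
    exact h2 (hq _ h)
  apply hγ
  have := r.add_mem (h h3) (key μ h1)
  rwa [Submodule.coe_sub, sub_add_cancel] at this

/-! ### Topes and polyhedral cones -/

/-- A sign-preserving form of Carathéodory's theorem for cones. -/
theorem exists_linearIndepOn_support {ι E : Type*} [AddCommGroup E] [Module ℝ E] (v : ι → E)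
    (n : ι →₀ ℝ) :
    ∃ m : ι →₀ ℝ, Finsupp.linearCombination ℝ v m = Finsupp.linearCombination ℝ v n ∧
      m.support ⊆ n.support ∧ (∀ i, 0 ≤ m i * n i) ∧
      LinearIndepOn ℝ v (m.support : Set ι) := by
  induction hk : n.support.card using Nat.strong_induction_on generalizing n with
  | _ k ih =>
    by_cases hind : LinearIndepOn ℝ v (n.support : Set ι)
    · exact ⟨n, rfl, subset_rfl, fun i => mul_self_nonneg _, hind⟩
    rw [linearIndepOn_iff] at hind
    push Not at hind
    obtain ⟨l, hl, hl0, hlne⟩ := hind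
    rw [Finsupp.mem_supported] at hl
    have hl' : l.support ⊆ n.support := by exact_mod_cast hl
    obtain ⟨i₀, hi₀, hmin⟩ := l.support.exists_min_image (fun i => |n i / l i|)
      (Finsupp.support_nonempty_iff.2 hlne)
    have hli₀ : l i₀ ≠ 0 := Finsupp.mem_support_iff.1 hi₀
    set s := n i₀ / l i₀ with hs
    set n' := n - s • l with hn'
    have hsub : n'.support ⊆ n.support := by
      intro i hi
      by_contra h
      have h1 : n i = 0 := by simpa using h
      have h2 : l i = 0 := by
        by_contra h2
        exact h (hl' (Finsupp.mem_support_iff.2 h2))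
      rw [Finsupp.mem_support_iff] at hi
      exact hi (by simp [hn', h1, h2])
    have hnot : i₀ ∉ n'.support := by
      simp [hn', hs, hli₀]
    have hlt : n'.support.card < k := by
      rw [← hk]
      exact Finset.card_lt_card ⟨hsub, fun h => hnot (h (hl' hi₀))⟩
    obtain ⟨m, hm1, hm2, hm3, hm4⟩ := ih _ hlt n' rfl
    have hsign : ∀ i, 0 ≤ n' i * n i := by
      intro i
      by_cases hi : i ∈ l.support
      · have hli : l i ≠ 0 := Finsupp.mem_support_iff.1 hi
        have h1 : |s| ≤ |n i / l i| := hmin i hi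
        rw [abs_div (n i), le_div_iff₀ (abs_pos.2 hli), ← abs_mul] at h1
        have h2 : s * l i * n i ≤ n i * n i := by
          calc s * l i * n i ≤ |s * l i * n i| := le_abs_self _
            _ = |s * l i| * |n i| := abs_mul _ _
            _ ≤ |n i| * |n i| := by gcongr
            _ = n i * n i := abs_mul_abs_self _
        simp only [hn', Finsupp.coe_sub, Finsupp.coe_smul, Pi.sub_apply, Pi.smul_apply,
          smul_eq_mul]
        linarith [sub_mul (n i) (s * l i) (n i)]
      · have : l i = 0 := by simpa using hi
        simp [hn', this, mul_self_nonneg]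
    refine ⟨m, ?_, hm2.trans hsub, fun i => ?_, hm4⟩
    · rw [hm1, hn', map_sub, map_smul, hl0, smul_zero, sub_zero]
    · by_cases hi : n' i = 0
      · have : m i = 0 := by
          by_contra h
          exact (Finsupp.mem_support_iff.1 (hm2 (Finsupp.mem_support_iff.2 h))) hi
        simp [this]
      · have h1 := mul_nonneg (hm3 i) (hsign i)
        have h2 : 0 < n' i * n' i := mul_self_pos.2 hi
        have h3 : m i * n' i * (n' i * n i) = m i * n i * (n' i * n' i) := by ring
        rw [h3] at h1
        exact nonneg_of_mul_nonneg_left h1 h2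

theorem rationalSubspace_le {L : List Γ} {W t : Submodule ℝ V}
    (hL : Submodule.span ℝ ((fun a : Γ => (a : V)) '' {a | a ∈ L}) = W)
    (ht : t ∈ rationalSubspaces L) : t ≤ W := by
  obtain ⟨s, hs, rfl⟩ := ht
  rw [← hL]
  exact Submodule.span_mono (Set.image_mono hs)

/-- The only rational subspace meeting `topeComplement L W` is `W`. -/
theorem eq_of_mem_topeComplement [FiniteDimensional ℝ V] {L : List Γ} {W t : Submodule ℝ V}
    (hL : Submodule.span ℝ ((fun a : Γ => (a : V)) '' {a | a ∈ L}) = W)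
    (ht : t ∈ rationalSubspaces L) {x : V} (hx : x ∈ topeComplement L W) (hxt : x ∈ t) :
    t = W := by
  induction hk : Module.finrank ℝ W - Module.finrank ℝ t using Nat.strong_induction_on
    generalizing t with
  | _ k ih =>
    by_contra hne
    have hle := rationalSubspace_le hL ht
    obtain ⟨a, haL, hat⟩ : ∃ a ∈ L, (a : V) ∉ t := by
      by_contra! H
      refine hne (le_antisymm hle ?_)
      rw [← hL, Submodule.span_le]
      rintro _ ⟨a, ha, rfl⟩
      exact H a ha
    obtain ⟨s, hs, hst⟩ := id ht
    simp only at hst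
    have ht' : t ⊔ Submodule.span ℝ {(a : V)} ∈ rationalSubspaces L := by
      refine ⟨s ∪ {a}, Set.union_subset hs (by simpa using haL), ?_⟩
      simp only [Set.image_union, Set.image_singleton, Submodule.span_union, hst]
    have hrank := Submodule.finrank_sup_span_singleton (K := ℝ) hat
    have hle' := rationalSubspace_le hL ht'
    have hle'' := Submodule.finrank_mono hle'
    have := ih _ (by omega) ht' (Submodule.mem_sup_left hxt) rfl
    rw [this] at hrank
    exact hx.2 t ht hle hrank.symm hxt

/-- A linear form without zeros on `topeComplement L W` has constant sign on topes. -/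
theorem pos_of_mem_connectedComponentIn {E : Type*} [TopologicalSpace E] {S : Set E}
    {φ : E → ℝ} (hc : Continuous φ) (hφ : ∀ z ∈ S, φ z ≠ 0) {x y : E} (hy : y ∈ S)
    (hx : x ∈ connectedComponentIn S y) (h : 0 < φ x) : 0 < φ y := by
  by_contra! h'
  obtain ⟨z, hz, hz0⟩ := isPreconnected_connectedComponentIn.intermediate_value
    (mem_connectedComponentIn hy) hx hc.continuousOn ⟨h', h.le⟩
  exact hφ z (connectedComponentIn_subset _ _ hz) hz0

theorem mul_pos_of_mem_connectedComponentIn {E : Type*} [TopologicalSpace E] {S : Set E}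
    {φ : E → ℝ} (hc : Continuous φ) (hφ : ∀ z ∈ S, φ z ≠ 0) {x y : E} (hy : y ∈ S)
    (hx : x ∈ connectedComponentIn S y) : 0 < φ x * φ y := by
  rcases lt_or_gt_of_ne (hφ x (connectedComponentIn_subset _ _ hx)) with h | h
  · have := pos_of_mem_connectedComponentIn (φ := fun z => - φ z) hc.neg
      (fun z hz => neg_ne_zero.2 (hφ z hz)) hy hx (neg_pos.2 h)
    exact mul_pos_of_neg_of_neg h (neg_pos.1 this)
  · exact mul_pos h (pos_of_mem_connectedComponentIn hc hφ hy hx h)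

/-- If a point of the tope of `y` lies in a cone generated by `± L` on which `u` is nonnegative,
then `u` is positive at `y`. -/
theorem inner_pos_of_mem_topeAt [FiniteDimensional ℝ V] {L : List Γ} {W : Submodule ℝ V}
    (hL : Submodule.span ℝ ((fun a : Γ => (a : V)) '' {a | a ∈ L}) = W) {u x y : V}
    (hy : y ∈ topeComplement L W) (hx : x ∈ topeAt L W y) (n : Γ →₀ ℝ)
    (hnL : ∀ a ∈ n.support, a ∈ L) (hn : ∀ a, 0 ≤ n a * inner ℝ u (a : V))
    (hnx : Finsupp.linearCombination ℝ (fun a : Γ => (a : V)) n = x)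
    (hu : ∃ a ∈ L, inner ℝ u (a : V) ≠ 0) : 0 < inner ℝ u y := by
  set v : Γ → V := fun a => (a : V) with hv
  obtain ⟨m, hm1, hm2, hm3, hm4⟩ := exists_linearIndepOn_support v n
  have hxS : x ∈ topeComplement L W := connectedComponentIn_subset _ _ hx
  have hrat : ∀ s : Set Γ, s ⊆ (m.support : Set Γ) →
      Submodule.span ℝ (v '' s) ∈ rationalSubspaces L := fun s hs =>
    ⟨s, fun a ha => hnL a (hm2 (hs ha)), rfl⟩
  have hspan : Submodule.span ℝ (v '' (m.support : Set Γ)) = W := by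
    refine eq_of_mem_topeComplement hL (hrat _ subset_rfl) hxS ?_
    rw [← hnx, ← hm1]
    exact (Finsupp.mem_span_image_iff_linearCombination ℝ).2
      ⟨m, Finsupp.mem_supported _ _ |>.2 subset_rfl, rfl⟩
  have hcoord : ∀ z ∈ W, ∃ c : Γ →₀ ℝ, c.support ⊆ m.support ∧
      Finsupp.linearCombination ℝ v c = z := by
    intro z hz
    rw [← hspan, Finsupp.mem_span_image_iff_linearCombination] at hz
    obtain ⟨c, hc, hcz⟩ := hz
    exact ⟨c, by exact_mod_cast (Finsupp.mem_supported _ _).1 hc, hcz⟩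
  obtain ⟨c, hc, hcy⟩ := hcoord y hy.1
  have hmc : ∀ i ∈ m.support, 0 < m i * c i := by
    intro i hi
    have hnot : v i ∉ Submodule.span ℝ (v '' ((m.support : Set Γ) \ {i})) := by
      refine (hm4.mono Set.sdiff_subset).notMem_span_iff.2 ⟨?_, by simp⟩
      rw [Set.insert_sdiff_singleton, Set.insert_eq_of_mem (by exact_mod_cast hi)]
      exact hm4
    obtain ⟨φ, hφi, hφ⟩ := Submodule.exists_le_ker_of_notMem hnot
    have hφj : ∀ d : Γ →₀ ℝ, d.support ⊆ m.support →
        φ (Finsupp.linearCombination ℝ v d) = d i * φ (v i) := by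
      intro d hd
      rw [Finsupp.linearCombination_apply, Finsupp.sum, map_sum]
      rw [Finset.sum_eq_single i]
      · simp
      · intro j hj hji
        have : φ (v j) = 0 := hφ (Submodule.subset_span ⟨j, ⟨hd hj, hji⟩, rfl⟩)
        simp [this]
      · intro h
        simp [Finsupp.notMem_support_iff.1 h]
    have hne : ∀ z ∈ topeComplement L W, φ z ≠ 0 := by
      intro z hz h0
      obtain ⟨d, hd, rfl⟩ := hcoord z hz.1
      rw [hφj d hd] at h0
      have hdi : d i = 0 := (mul_eq_zero.1 h0).resolve_right hφi
      have hmem : Finsupp.linearCombination ℝ v d ∈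
          Submodule.span ℝ (v '' ((m.support : Set Γ) \ {i})) := by
        refine (Finsupp.mem_span_image_iff_linearCombination ℝ).2
          ⟨d, (Finsupp.mem_supported _ _).2 fun j hj => ⟨hd hj, ?_⟩, rfl⟩
        rintro rfl
        exact Finsupp.mem_support_iff.1 hj hdi
      have := eq_of_mem_topeComplement hL (hrat _ Set.sdiff_subset) hz hmem
      rw [this, ← hspan] at hnot
      exact hnot (Submodule.subset_span ⟨i, hi, rfl⟩)
    have := mul_pos_of_mem_connectedComponentIn φ.continuous_of_finiteDimensional hne hy hx
    rw [← hcy, ← hnx, ← hm1, hφj c hc, hφj m subset_rfl] at this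
    have h2 : m i * φ (v i) * (c i * φ (v i)) = m i * c i * (φ (v i) * φ (v i)) := by ring
    rw [h2] at this
    exact pos_of_mul_pos_left this (mul_self_nonneg _)
  have hterm : ∀ i ∈ m.support, inner ℝ u (v i) ≠ 0 → 0 < c i * inner ℝ u (v i) := by
    intro i hi hui
    have hmi : m i ≠ 0 := Finsupp.mem_support_iff.1 hi
    have hni : n i ≠ 0 := Finsupp.mem_support_iff.1 (hm2 hi)
    have h1 : 0 < m i * n i := lt_of_le_of_ne (hm3 i) (mul_ne_zero hmi hni).symm
    have h2 : 0 < n i * inner ℝ u (v i) := lt_of_le_of_ne (hn i) (mul_ne_zero hni hui).symm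
    have h3 := mul_pos (mul_pos h1 h2) (hmc i hi)
    have h4 : m i * n i * (n i * inner ℝ u (v i)) * (m i * c i)
        = c i * inner ℝ u (v i) * ((m i * n i) * (m i * n i)) := by ring
    rw [h4] at h3
    exact pos_of_mul_pos_left h3 (mul_self_nonneg _)
  have hsum : inner ℝ u y = ∑ i ∈ m.support, c i * inner ℝ u (v i) := by
    rw [← hcy, Finsupp.linearCombination_apply, Finsupp.sum_of_support_subset _ hc _ (by simp),
      inner_sum]
    simp [inner_smul_right]
  rw [hsum]
  obtain ⟨a, haL, hua⟩ := hu
  have hex : ∃ i ∈ m.support, inner ℝ u (v i) ≠ 0 := by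
    by_contra! H
    apply hua
    have haW : (a : V) ∈ W := hL ▸ Submodule.subset_span ⟨a, haL, rfl⟩
    obtain ⟨d, hd, hda⟩ := hcoord _ haW
    rw [← hda, Finsupp.linearCombination_apply, Finsupp.sum, inner_sum]
    refine Finset.sum_eq_zero fun i hi => ?_
    rw [inner_smul_right, H i (hd hi), mul_zero]
  obtain ⟨i, hi, hui⟩ := hex
  refine Finset.sum_pos' (fun j hj => ?_) ⟨i, hi, hterm i hi hui⟩
  by_cases h : inner ℝ u (v j) = 0
  · simp [h]
  · exact (hterm j hj h).le

/-! ### Zonotopes -/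

theorem mem_zonotope_cons {a : Γ} {L : List Γ} {b : V} :
    b ∈ zonotope (a :: L) ↔
      ∃ t : ℝ, 0 ≤ t ∧ t ≤ 1 ∧ ∃ b' ∈ zonotope L, b = t • (a : V) + b' := by
  constructor
  · rintro ⟨t, ht, rfl⟩
    refine ⟨t ⟨0, by simp⟩, (ht _).1, (ht _).2, _,
      ⟨fun i : Fin L.length => t i.succ, fun i => ht _, rfl⟩, ?_⟩
    exact Fin.sum_univ_succ (n := L.length) (fun i => t i • (((a :: L).get i : Γ) : V))
  · rintro ⟨s, h0, h1, _, ⟨t, ht, rfl⟩, rfl⟩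
    refine ⟨(Fin.cons s t : Fin (L.length + 1) → ℝ), fun i => ?_, ?_⟩
    · refine Fin.cases (motive := fun i : Fin (L.length + 1) =>
        0 ≤ (Fin.cons s t : Fin (L.length + 1) → ℝ) i ∧
          (Fin.cons s t : Fin (L.length + 1) → ℝ) i ≤ 1) ⟨h0, h1⟩ (fun j => ?_) i
      simpa using ht j
    · exact (Fin.sum_univ_succ (n := L.length)
        (fun i => (Fin.cons s t : Fin (L.length + 1) → ℝ) i • (((a :: L).get i : Γ) : V))).symm

theorem zero_mem_zonotope (L : List Γ) : (0 : V) ∈ zonotope L :=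
  ⟨0, fun _ => by simp, by simp⟩

theorem exists_add_of_mem_zonotope {L : List Γ} (t : Submodule ℝ V) {b : V}
    (hb : b ∈ zonotope L) :
    ∃ b₁ ∈ spanInside L t, ∃ b₂ ∈ zonotope (outside L t), b = b₁ + b₂ := by
  induction L generalizing b with
  | nil =>
    refine ⟨0, Submodule.zero_mem _, b, hb, by simp⟩
  | cons a L ih =>
    obtain ⟨s, h0, h1, b', hb', rfl⟩ := mem_zonotope_cons.1 hb
    obtain ⟨b₁, hb₁, b₂, hb₂, rfl⟩ := ih hb'
    have hmono : spanInside L t ≤ spanInside (a :: L) t :=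
      Submodule.span_mono (Set.image_mono fun c hc => ⟨by simp [hc.1], hc.2⟩)
    by_cases ha : (a : V) ∈ t
    · refine ⟨s • (a : V) + b₁, Submodule.add_mem _ (Submodule.smul_mem _ _
        ((mem_spanInside (by simp)).2 ha)) (hmono hb₁), b₂, ?_, by abel⟩
      have : outside (a :: L) t = outside L t := by simp [outside, ha]
      rwa [this]
    · refine ⟨b₁, hmono hb₁, s • (a : V) + b₂, ?_, by abel⟩
      have : outside (a :: L) t = a :: outside L t := by simp [outside, ha]
      rw [this]
      exact mem_zonotope_cons.2 ⟨s, h0, h1, b₂, hb₂, rfl⟩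

theorem exists_linearCombination_of_partitionFn_ne_zero {L : List Γ} {F : Set V} {u : V}
    (hu : IsPositiveFor F u L) {γ : Γ} (h : partitionFn L F γ ≠ 0) {b : V}
    (hb : b ∈ zonotope L) :
    ∃ n : Γ →₀ ℝ, (∀ a ∈ n.support, a ∈ L) ∧ (∀ a, 0 ≤ n a * inner ℝ u (a : V)) ∧
      Finsupp.linearCombination ℝ (fun a : Γ => (a : V)) n = γ + b := by
  classical
  induction L generalizing γ b with
  | nil =>
    obtain ⟨t, -, rfl⟩ := hb
    rw [partitionFn_nil] at h
    refine ⟨0, by simp, by simp, ?_⟩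
    rw [eq_zero_of_delta0_ne_zero h]
    simp
  | cons a L ih =>
    obtain ⟨s, h0, h1, b', hb', rfl⟩ := mem_zonotope_cons.1 hb
    rw [partitionFn_cons] at h
    obtain ⟨μ, hμ, hν⟩ := exists_of_conv_ne_zero h
    obtain ⟨n, hn1, hn2, hn3⟩ := ih (hu.mono (by simp +contextual)) hν hb'
    obtain ⟨k, hk, hk'⟩ := geomSeries_support_add hμ h0 h1
    have hpos := hu a (by simp)
    obtain ⟨c, hc, hc'⟩ : ∃ c : ℝ, 0 ≤ c * inner ℝ u (a : V) ∧
        k • (posDir F a : V) = c • (a : V) := by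
      rcases posDir_eq_or F a with e | e
      · rw [e] at hpos ⊢
        exact ⟨k, mul_nonneg hk hpos.le, rfl⟩
      · rw [e] at hpos ⊢
        refine ⟨-k, ?_, by simp⟩
        have := mul_nonneg hk hpos.le
        simpa using this
    refine ⟨Finsupp.single a c + n, ?_, ?_, ?_⟩
    · intro i hi
      rcases Finset.mem_union.1 (Finsupp.support_add hi) with h | h
      · rw [Finset.mem_singleton.1 (Finsupp.support_single_subset h)]; simp
      · simp [hn1 i h]
    · intro i
      rw [Finsupp.add_apply, add_mul]
      refine add_nonneg ?_ (hn2 i)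
      rw [Finsupp.single_apply]
      split_ifs with e
      · rw [← e]; exact hc
      · simp
    · rw [map_add, Finsupp.linearCombination_single, hn3, ← hc', ← hk', Submodule.coe_sub]
      abel

/-- The function `P * q` attached to a proper rational subspace vanishes on `τ - B(L)` if `u` is
nonpositive at some point of the tope `τ`. -/
theorem conv_partitionFn_eq_zero [FiniteDimensional ℝ V] {L : List Γ} {W t : Submodule ℝ V}
    (hL : Submodule.span ℝ ((fun a : Γ => (a : V)) '' {a | a ∈ L}) = W)
    (ht : t ∈ rationalSubspaces L) (htW : t ≠ W) {F : Set V} {u y : V} (hut : u ∈ tᗮ)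
    (hu : IsPositiveFor F u (outside L t)) {q : Γ → ℤ} (hq : SupportedOn t q)
    (hy : y ∈ topeComplement L W) (huy : inner ℝ u y ≤ 0) {γ : Γ}
    (hγ : ∃ x ∈ topeAt L W y, ∃ b ∈ zonotope L, (γ : V) = x - b) :
    conv (partitionFn (outside L t) F) q γ = 0 := by
  by_contra hne
  obtain ⟨x, hx, b, hb, hγx⟩ := hγ
  obtain ⟨μ, hμ, hν⟩ := exists_of_conv_ne_zero hne
  have hνt : ((γ - μ : Γ) : V) ∈ t := by
    by_contra h
    exact hν (hq _ h)
  obtain ⟨b₁, hb₁, b₂, hb₂, rfl⟩ := exists_add_of_mem_zonotope t hb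
  obtain ⟨n, hn1, hn2, hn3⟩ := exists_linearCombination_of_partitionFn_ne_zero hu hμ hb₂
  have hts := spanInside_of_mem ht
  have hw : ((γ - μ : Γ) : V) + b₁ ∈ spanInside L t :=
    Submodule.add_mem _ (hts.symm ▸ hνt) hb₁
  obtain ⟨d, hd, hd'⟩ := (Finsupp.mem_span_image_iff_linearCombination ℝ).1 hw
  rw [Finsupp.mem_supported] at hd
  have hinner : ∀ a, d a * inner ℝ u (a : V) = 0 := by
    intro a
    by_cases ha : d a = 0
    · simp [ha]
    · have := (hd (Finsupp.mem_support_iff.2 ha)).2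
      rw [(Submodule.mem_orthogonal' t u).1 hut _ this, mul_zero]
  refine absurd huy (not_le.2 (inner_pos_of_mem_topeAt hL hy hx (d + n) ?_ ?_ ?_ ?_))
  · classical
    intro a ha
    rcases Finset.mem_union.1 (Finsupp.support_add ha) with h | h
    · exact (hd h).1
    · exact (mem_outside.1 (hn1 a h)).1
  · intro a
    rw [Finsupp.add_apply, add_mul, hinner, zero_add]
    exact hn2 a
  · rw [map_add, hd', hn3, Submodule.coe_sub, hγx]
    abel
  · by_contra! H
    refine htW (le_antisymm (rationalSubspace_le hL ht) ?_)
    rw [← hL, Submodule.span_le]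
    rintro _ ⟨a, ha, rfl⟩
    by_contra hat
    exact hu.inner_ne_zero (mem_outside.2 ⟨ha, hat⟩) (H a ha)

/-! ### Lattice points in real subspaces -/

/-- A lattice vector in the real span of a set of lattice vectors has a positive multiple in its
integral span. -/
theorem exists_nsmul_mem_span [FiniteDimensional ℝ V] [DiscreteTopology Γ] [IsZLattice ℝ Γ]
    (S : Set Γ) {c : Γ} (hc : (c : V) ∈ Submodule.span ℝ ((fun a : Γ => (a : V)) '' S)) :
    ∃ N : ℕ, 0 < N ∧ N • c ∈ Submodule.span ℤ S := by
  have := ZLattice.module_free ℝ Γ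
  have := ZLattice.module_finite ℝ Γ
  set Q := Γ ⧸ Submodule.span ℤ S
  by_cases ht : (Submodule.Quotient.mk c : Q) ∈ Submodule.torsion ℤ Q
  · obtain ⟨⟨n, hn⟩, hn'⟩ := (Submodule.mem_torsion_iff _).1 ht
    have hn0 : n ≠ 0 := nonZeroDivisors.ne_zero hn
    have h1 : n • c ∈ Submodule.span ℤ S := by
      rw [← Submodule.Quotient.mk_eq_zero]
      exact hn'
    refine ⟨n.natAbs, Int.natAbs_pos.2 hn0, ?_⟩
    rcases Int.natAbs_eq n with e | e
    · rw [e, natCast_zsmul] at h1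
      exact h1
    · rw [e, neg_smul, natCast_zsmul] at h1
      exact (Submodule.neg_mem_iff _).1 h1
  · exfalso
    have h1 : (Submodule.Quotient.mk (Submodule.Quotient.mk c : Q) :
        Q ⧸ Submodule.torsion ℤ Q) ≠ 0 := by
      rwa [Ne, Submodule.Quotient.mk_eq_zero]
    rw [Ne, ← Module.forall_dual_apply_eq_zero_iff ℤ] at h1
    push Not at h1
    obtain ⟨ψ, hψ⟩ := h1
    set φ : Γ →ₗ[ℤ] ℤ := ψ ∘ₗ Submodule.mkQ _ ∘ₗ Submodule.mkQ (Submodule.span ℤ S) with hφ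
    have hφc : φ c ≠ 0 := hψ
    have hφS : ∀ a ∈ S, φ a = 0 := by
      intro a ha
      have : (Submodule.Quotient.mk a : Q) = 0 :=
        (Submodule.Quotient.mk_eq_zero _).2 (Submodule.subset_span ha)
      change ψ (Submodule.Quotient.mk (Submodule.Quotient.mk a : Q)) = 0
      rw [this]
      simp
    let b := Module.Free.chooseBasis ℤ Γ
    let b' := b.ofZLatticeBasis ℝ Γ
    let Φ : V →ₗ[ℝ] ℝ := b'.constr ℝ fun i => ((φ (b i) : ℤ) : ℝ)
    have hΦ : ∀ γ : Γ, Φ (γ : V) = φ γ := by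
      have : (Φ.restrictScalars ℤ) ∘ₗ Γ.subtype = (Algebra.linearMap ℤ ℝ) ∘ₗ φ := by
        refine b.ext fun i => ?_
        have e : ((b i : Γ) : V) = b' i := (b.ofZLatticeBasis_apply ℝ Γ i).symm
        simp only [LinearMap.comp_apply, Submodule.subtype_apply, LinearMap.restrictScalars_apply,
          e, Φ, Module.Basis.constr_basis]
        simp
      intro γ
      have := LinearMap.congr_fun this γ
      simpa using this
    have hle : Submodule.span ℝ ((fun a : Γ => (a : V)) '' S) ≤ LinearMap.ker Φ := by
      rw [Submodule.span_le]
      rintro _ ⟨a, ha, rfl⟩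
      simp [hΦ, hφS a ha]
    have := hle hc
    rw [LinearMap.mem_ker, hΦ] at this
    exact hφc (by exact_mod_cast this)

/-- Integral spans of lattice vectors spanning `W` have finite index in `Γ ∩ W`. -/
theorem relIndex_span_ne_zero [FiniteDimensional ℝ V] [DiscreteTopology Γ] [IsZLattice ℝ Γ]
    (S : Set Γ) {W : Submodule ℝ V}
    (hS : Submodule.span ℝ ((fun a : Γ => (a : V)) '' S) = W) :
    (Submodule.span ℤ S).toAddSubgroup.relIndex (latticeIn Γ W) ≠ 0 := by
  have := ZLattice.module_free ℝ Γ
  have := ZLattice.module_finite ℝ Γ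
  set K : Submodule ℤ Γ := (latticeIn Γ W).toIntSubmodule
  set N : Submodule ℤ K := (Submodule.span ℤ S).comap K.subtype
  have : Finite (K ⧸ N) := by
    refine Module.finite_of_fg_torsion _ ?_
    intro x
    obtain ⟨⟨c, hc⟩, rfl⟩ := Submodule.Quotient.mk_surjective _ x
    obtain ⟨n, hn, hn'⟩ := exists_nsmul_mem_span S (c := c) (hS.symm ▸ hc)
    refine ⟨⟨(n : ℤ), mem_nonZeroDivisors_of_ne_zero (by exact_mod_cast hn.ne')⟩, ?_⟩
    change Submodule.Quotient.mk ((n : ℤ) • (⟨c, hc⟩ : K)) = 0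
    rw [Submodule.Quotient.mk_eq_zero]
    change (n : ℤ) • c ∈ Submodule.span ℤ S
    rwa [natCast_zsmul]
  have : Finite ((latticeIn Γ W) ⧸
      ((Submodule.span ℤ S).toAddSubgroup.addSubgroupOf (latticeIn Γ W))) :=
    inferInstanceAs (Finite (K ⧸ N))
  exact (AddSubgroup.finiteIndex_of_finite_quotient).index_ne_zero

/-! ### The operators `∇_a` on `DM(L)` are nilpotent along a sublattice -/

/-- The annihilator of a function in the group ring. -/
noncomputable def annihilatorIdeal (q : Γ → ℤ) : Ideal (AddMonoidAlgebra ℤ Γ) where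
  carrier := {z | groupRingAction Γ z q = 0}
  add_mem' {x y} hx hy := by
    simp only [Set.mem_ofPred_eq] at hx hy ⊢
    rw [map_add, LinearMap.add_apply, hx, hy, add_zero]
  zero_mem' := by simp
  smul_mem' z x hx := by
    simp only [Set.mem_ofPred_eq] at hx ⊢
    rw [smul_eq_mul, map_mul, Module.End.mul_apply, hx, map_zero]

/-- The subgroup of the `γ` with `1 - e^γ` in a given ideal. -/
noncomputable def oneSubExpSubgroup (P : Ideal (AddMonoidAlgebra ℤ Γ)) : AddSubgroup Γ where
  carrier := {γ | oneSubExp γ ∈ P}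
  zero_mem' := by
    have : oneSubExp (0 : Γ) = 0 := sub_self _
    simp [this]
  add_mem' {x y} hx hy := by
    have : oneSubExp (x + y)
        = oneSubExp x + AddMonoidAlgebra.single x 1 * oneSubExp y := by
      simp [oneSubExp, mul_sub, AddMonoidAlgebra.single_mul_single]
    simp only [Set.mem_ofPred_eq] at hx hy ⊢
    rw [this]
    exact P.add_mem hx (P.mul_mem_left _ hy)
  neg_mem' {x} hx := by
    have : oneSubExp (-x) = AddMonoidAlgebra.single (-x) (-1) * oneSubExp x := by
      have h2 : (AddMonoidAlgebra.single (-x) (-1) : AddMonoidAlgebra ℤ Γ)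
        = - AddMonoidAlgebra.single (-x) 1 := by rw [← AddMonoidAlgebra.single_neg]
      simp [oneSubExp, mul_sub, AddMonoidAlgebra.single_mul_single, h2]
      rw [AddMonoidAlgebra.one_def]
      abel
    simp only [Set.mem_ofPred_eq] at hx ⊢
    rw [this]
    exact P.mul_mem_left _ hx

theorem groupRingAction_oneSubExp_pow (d : Γ) (M : ℕ) (f : Γ → ℤ) :
    groupRingAction Γ (oneSubExp d ^ M) f = (nabla d)^[M] f := by
  induction M generalizing f with
  | zero => simp
  | succ M ih =>
    rw [pow_succ, map_mul, Module.End.mul_apply, groupRingAction_oneSubExp, ih,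
      Function.iterate_succ_apply]

theorem nabla_iterate_comm (c d : Γ) (M N : ℕ) (f : Γ → ℤ) :
    (nabla c)^[M] ((nabla d)^[N] f) = (nabla d)^[N] ((nabla c)^[M] f) := by
  simp only [← groupRingAction_oneSubExp_pow, ← Module.End.mul_apply, ← map_mul]
  rw [mul_comm]

theorem nabla_iterate_zero (c : Γ) (M : ℕ) : (nabla c)^[M] (0 : Γ → ℤ) = 0 := by
  rw [← groupRingAction_oneSubExp_pow, map_zero]

theorem exists_nabla_iterate_eq_zero [FiniteDimensional ℝ V] [DiscreteTopology Γ]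
    [IsZLattice ℝ Γ] {L : List Γ} {W : Submodule ℝ V} {q : Γ → ℤ} (hq : q ∈ DM L W)
    {c : Γ} (hc : (c : V) ∈ W) :
    ∃ N : ℕ, 0 < N ∧ ∃ M : ℕ, (nabla (N • c))^[M] q = 0 := by
  classical
  have h1 : ∀ S : Finset Γ, ∃ N : ℕ, 0 < N ∧
      (Submodule.span ℝ ((fun a : Γ => (a : V)) '' (S : Set Γ)) = W →
        N • c ∈ Submodule.span ℤ (S : Set Γ)) := by
    intro S
    by_cases hS : Submodule.span ℝ ((fun a : Γ => (a : V)) '' (S : Set Γ)) = W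
    · obtain ⟨N, hN, hN'⟩ := exists_nsmul_mem_span (S : Set Γ) (c := c) (hS.symm ▸ hc)
      exact ⟨N, hN, fun _ => hN'⟩
    · exact ⟨1, one_pos, fun h => absurd h hS⟩
  choose N hN hN' using h1
  refine ⟨∏ S ∈ L.toFinset.powerset, N S, Finset.prod_pos fun S _ => hN S, ?_⟩
  set n := ∏ S ∈ L.toFinset.powerset, N S with hn
  have key : oneSubExp (n • c) ∈ (annihilatorIdeal q).radical := by
    rw [Ideal.radical_eq_sInf, Submodule.mem_sInf]
    rintro P ⟨hP, hPp⟩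
    set S : Finset Γ := L.toFinset.filter (fun a => oneSubExp a ∈ P) with hSdef
    have hSW : Submodule.span ℝ ((fun a : Γ => (a : V)) '' (S : Set Γ)) = W := by
      by_contra hne
      set t := Submodule.span ℝ ((fun a : Γ => (a : V)) '' (S : Set Γ)) with ht
      have htr : t ∈ rationalSubspaces L := ⟨S, fun a ha => by
        have := (Finset.mem_filter.1 (Finset.mem_coe.1 ha)).1
        simpa using this, rfl⟩
      have h0 := hq.2 t htr hne
      rw [nablaList_eq_groupRingAction] at h0
      have h2 : ((outside L t).map oneSubExp).prod ∈ P := hP h0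
      obtain ⟨z, hz, hzP⟩ := (hPp.multiset_prod_mem_iff_exists_mem
        (s := ((outside L t).map oneSubExp : Multiset _))).1 (by simpa using h2)
      obtain ⟨a, ha, rfl⟩ := List.mem_map.1 (Multiset.mem_coe.1 hz)
      obtain ⟨haL, hat⟩ := mem_outside.1 ha
      exact hat (Submodule.subset_span ⟨a, by simp [hSdef, haL, hzP], rfl⟩)
    have h3 := hN' S hSW
    have hdvd : N S ∣ n := Finset.dvd_prod_of_mem _ (by
      rw [Finset.mem_powerset, hSdef]
      exact Finset.filter_subset _ _)
    have h4 : n • c ∈ Submodule.span ℤ (S : Set Γ) := by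
      obtain ⟨k, hk⟩ := hdvd
      rw [hk, mul_comm, mul_smul]
      exact nsmul_mem h3 k
    have h5 : Submodule.span ℤ (S : Set Γ) ≤ (oneSubExpSubgroup P).toIntSubmodule := by
      rw [Submodule.span_le]
      intro a ha
      exact (Finset.mem_filter.1 (Finset.mem_coe.1 ha)).2
    exact h5 h4
  obtain ⟨M, hM⟩ := key
  refine ⟨M, ?_⟩
  rw [← groupRingAction_oneSubExp_pow]
  exact hM

/-! ### Newton interpolation -/

/-- The polynomial `x (x + 1) ⋯ (x + k - 1) / k!`. -/
noncomputable def newtonPoly (k : ℕ) : Polynomial ℝ :=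
  Polynomial.C ((k.factorial : ℝ)⁻¹) * ascPochhammer ℝ k

theorem newtonPoly_zero (x : ℝ) : (newtonPoly 0).eval x = 1 := by
  simp [newtonPoly]

theorem newtonPoly_succ_zero (k : ℕ) : (newtonPoly (k + 1)).eval 0 = 0 := by
  simp [newtonPoly]

theorem newtonPoly_succ_sub (k : ℕ) (x : ℝ) :
    (newtonPoly (k + 1)).eval x - (newtonPoly (k + 1)).eval (x - 1) = (newtonPoly k).eval x := by
  have h1 : (ascPochhammer ℝ (k + 1)).eval (x - 1) = (x - 1) * (ascPochhammer ℝ k).eval x := by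
    rw [ascPochhammer_succ_left]
    simp
  simp only [newtonPoly, Polynomial.eval_mul, Polynomial.eval_C, h1, ascPochhammer_succ_eval]
  have h2 : ((k + 1).factorial : ℝ) = (k + 1) * k.factorial := by
    rw [Nat.factorial_succ]; push_cast; ring
  have h3 : (k.factorial : ℝ) ≠ 0 := by positivity
  have h4 : (k + 1 : ℝ) ≠ 0 := by positivity
  rw [h2]
  field_simp
  ring

theorem newton_interpolation (d : Γ) (M : ℕ) {h : Γ → ℤ} (hM : (nabla d)^[M] h = 0) (γ : Γ)
    (n : ℤ) :
    (h (γ + n • d) : ℝ)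
      = ∑ k ∈ Finset.range M, (newtonPoly k).eval (n : ℝ) * ((nabla d)^[k] h γ : ℤ) := by
  induction M generalizing h n with
  | zero =>
    have : h = 0 := hM
    simp [this]
  | succ M ih =>
    set G : ℤ → ℝ := fun n =>
      ∑ k ∈ Finset.range (M + 1), (newtonPoly k).eval (n : ℝ) * ((nabla d)^[k] h γ : ℤ) with hG
    have hG0 : (h γ : ℝ) = G 0 := by
      simp only [hG, Finset.sum_range_succ', Int.cast_zero, newtonPoly_succ_zero,
        newtonPoly_zero]
      simp
    have hstep : ∀ n : ℤ, (h (γ + n • d) : ℝ) - h (γ + (n - 1) • d) = G n - G (n - 1) := by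
      intro n
      have h1 := ih (h := nabla d h) (by rw [← Function.iterate_succ_apply]; exact hM) n
      have h2 : (nabla d h (γ + n • d) : ℝ)
          = (h (γ + n • d) : ℝ) - h (γ + (n - 1) • d) := by
        simp only [nabla, Int.cast_sub]
        congr 3
        rw [sub_smul, one_smul]
        abel
      rw [← h2, h1]
      simp only [hG, Finset.sum_range_succ', newtonPoly_zero, add_sub_add_right_eq_sub,
        ← Finset.sum_sub_distrib, ← sub_mul, Int.cast_sub, Int.cast_one, newtonPoly_succ_sub,
        Function.iterate_succ_apply]
    change (h (γ + n • d) : ℝ) = G n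
    induction n using Int.induction_on with
    | zero => simpa using hG0
    | succ i hi =>
      have := hstep (i + 1)
      rw [add_sub_cancel_right] at this
      linarith
    | pred i hi =>
      have := hstep (-i)
      linarith

theorem exists_polynomialFunction {ι : Type*} [Fintype ι] (d : ι → Γ)
    (φ : ι → Module.Dual ℝ V) (hφ : ∀ i, φ i (d i : V) = 1)
    (hφ' : ∀ i j, i ≠ j → φ i (d j : V) = 0) (s : Finset ι) (h : Γ → ℤ)
    (hh : ∀ i ∈ s, ∃ M, (nabla (d i))^[M] h = 0) (γ : Γ) :
    ∃ p ∈ polynomialFunctions V, ∀ n : ι → ℤ,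
      (h (γ + ∑ i ∈ s, n i • d i) : ℝ) = p ((γ + ∑ i, n i • d i : Γ) : V) := by
  classical
  induction s using Finset.induction_on generalizing h with
  | empty =>
    refine ⟨algebraMap ℝ _ (h γ : ℝ), Subalgebra.algebraMap_mem _ _, fun n => ?_⟩
    simp
  | insert j s hj ih =>
    obtain ⟨M, hM⟩ := hh j (by simp)
    have h1 : ∀ k : ℕ, ∃ p ∈ polynomialFunctions V, ∀ n : ι → ℤ,
        ((nabla (d j))^[k] h (γ + ∑ i ∈ s, n i • d i) : ℝ)
          = p ((γ + ∑ i, n i • d i : Γ) : V) := by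
      intro k
      refine ih _ fun i hi => ?_
      obtain ⟨M', hM'⟩ := hh i (by simp [hi])
      exact ⟨M', by rw [nabla_iterate_comm, hM', nabla_iterate_zero]⟩
    choose p hp hp' using h1
    set x : V → ℝ := (φ j : V → ℝ) - algebraMap ℝ (V → ℝ) (φ j (γ : V)) with hx
    have hxmem : x ∈ polynomialFunctions V :=
      Subalgebra.sub_mem _ (Algebra.subset_adjoin ⟨φ j, rfl⟩) (Subalgebra.algebraMap_mem _ _)
    have hxpoly : ∀ P : Polynomial ℝ, Polynomial.aeval x P ∈ polynomialFunctions V := fun P => by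
      have := (Polynomial.aeval (⟨x, hxmem⟩ : polynomialFunctions V) P).2
      have e : Polynomial.aeval x P
          = (Polynomial.aeval (⟨x, hxmem⟩ : polynomialFunctions V) P : V → ℝ) :=
        Polynomial.aeval_algHom_apply (polynomialFunctions V).val ⟨x, hxmem⟩ P
      rwa [e]
    have hxeval : ∀ (P : Polynomial ℝ) (v : V), Polynomial.aeval x P v = P.eval (x v) := by
      intro P v
      have := Polynomial.aeval_algHom_apply (Pi.evalAlgHom ℝ (fun _ : V => ℝ) v) x P
      rw [Pi.evalAlgHom_apply, Pi.evalAlgHom_apply] at this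
      rw [← this, Polynomial.coe_aeval_eq_eval]
    refine ⟨∑ k ∈ Finset.range M, Polynomial.aeval x (newtonPoly k) * p k,
      Subalgebra.sum_mem _ fun k _ => Subalgebra.mul_mem _ (hxpoly _) (hp k), fun n => ?_⟩
    rw [Finset.sum_insert hj, add_comm (n j • d j), ← add_assoc,
      newton_interpolation (d j) M hM, Finset.sum_apply]
    refine Finset.sum_congr rfl fun k _ => ?_
    rw [Pi.mul_apply, hxeval, hp' k n]
    congr 2
    simp only [hx, Pi.sub_apply, Pi.algebraMap_apply, Algebra.algebraMap_self, RingHom.id_apply,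
      Submodule.coe_add, map_add, add_sub_cancel_left]
    rw [AddSubmonoidClass.coe_finsetSum, map_sum, Finset.sum_eq_single j]
    · rw [Submodule.coe_smul, ← Int.cast_smul_eq_zsmul ℝ, map_smul, hφ, smul_eq_mul, mul_one]
    · intro i _ hij
      rw [Submodule.coe_smul, ← Int.cast_smul_eq_zsmul ℝ, map_smul, hφ' j i hij.symm, smul_zero]
    · simp

/-- The elements of `DM(L)` are quasi-polynomials. -/
theorem isQuasiPolynomial_of_mem_DM [FiniteDimensional ℝ V] [DiscreteTopology Γ]
    [IsZLattice ℝ Γ] {L : List Γ} {W : Submodule ℝ V}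
    (hL : Submodule.span ℝ ((fun a : Γ => (a : V)) '' {a | a ∈ L}) = W) {q : Γ → ℤ}
    (hq : q ∈ DM L W) : IsQuasiPolynomial W q := by
  set v : Γ → V := fun a => (a : V) with hv
  obtain ⟨b, hbL, -, hspan, hind⟩ := exists_linearIndepOn_extension (K := ℝ) (v := v)
    (linearIndepOn_empty ℝ v) (Set.empty_subset {a | a ∈ L})
  have hbW : Submodule.span ℝ (v '' b) = W := by
    refine le_antisymm (hL ▸ Submodule.span_mono (Set.image_mono hbL)) ?_
    rw [← hL]
    exact Submodule.span_le.2 hspan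
  have : Fintype b := ((List.finite_toSet L).subset hbL).fintype
  have hbmem : ∀ i : b, (i.1 : V) ∈ W := fun i => hbW ▸ Submodule.subset_span ⟨i.1, i.2, rfl⟩
  choose N hN M hM using fun i : b => exists_nabla_iterate_eq_zero hq (hbmem i)
  set d : b → Γ := fun i => N i • i.1 with hd
  have hdV : ∀ i, (d i : V) = (N i : ℝ) • (i.1 : V) := fun i => coe_nsmul_real _ _
  have hφ : ∀ i : b, ∃ φ : Module.Dual ℝ V, φ (d i : V) = 1 ∧
      ∀ j, i ≠ j → φ (d j : V) = 0 := by
    intro i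
    have hnot : v i.1 ∉ Submodule.span ℝ (v '' (b \ {i.1})) := by
      refine (hind.mono Set.sdiff_subset).notMem_span_iff.2 ⟨?_, by simp⟩
      rw [Set.insert_sdiff_singleton, Set.insert_eq_of_mem i.2]
      exact hind
    obtain ⟨φ, hφi, hφ⟩ := Submodule.exists_le_ker_of_notMem hnot
    have hNi : (N i : ℝ) ≠ 0 := by exact_mod_cast (hN i).ne'
    have hφi' : φ (i.1 : V) ≠ 0 := hφi
    refine ⟨((N i : ℝ) * φ (i.1 : V))⁻¹ • φ, ?_, fun j hij => ?_⟩
    · rw [LinearMap.smul_apply, hdV, map_smul, smul_eq_mul, smul_eq_mul,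
        inv_mul_cancel₀ (mul_ne_zero hNi hφi')]
    · have : φ (j.1 : V) = 0 := hφ (Submodule.subset_span
        ⟨j.1, ⟨j.2, fun h => hij (Subtype.ext h.symm)⟩, rfl⟩)
      rw [LinearMap.smul_apply, hdV, map_smul, this, smul_zero, smul_zero]
  choose φ hφ hφ' using hφ
  have hspand : Submodule.span ℝ (v '' Set.range d) = W := by
    rw [← hbW]
    refine le_antisymm (Submodule.span_le.2 ?_) (Submodule.span_le.2 ?_)
    · rintro _ ⟨_, ⟨i, rfl⟩, rfl⟩
      change (d i : V) ∈ _
      rw [hdV]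
      exact Submodule.smul_mem _ _ (Submodule.subset_span ⟨i.1, i.2, rfl⟩)
    · rintro _ ⟨a, ha, rfl⟩
      have hNi : (N ⟨a, ha⟩ : ℝ) ≠ 0 := by exact_mod_cast (hN _).ne'
      have : v a = (N ⟨a, ha⟩ : ℝ)⁻¹ • (d ⟨a, ha⟩ : V) := by
        rw [hdV, smul_smul, inv_mul_cancel₀ hNi, one_smul]
      rw [this]
      exact Submodule.smul_mem _ _ (Submodule.subset_span ⟨_, ⟨_, rfl⟩, rfl⟩)
  refine ⟨hq.1, (Submodule.span ℤ (Set.range d)).toAddSubgroup, ?_,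
    relIndex_span_ne_zero _ hspand, fun γ _ => ?_⟩
  · have : Submodule.span ℤ (Set.range d) ≤ (latticeIn Γ W).toIntSubmodule := by
      rw [Submodule.span_le]
      rintro _ ⟨i, rfl⟩
      change (d i : V) ∈ W
      rw [hdV]
      exact W.smul_mem _ (hbmem i)
    exact this
  · obtain ⟨p, hp, hp'⟩ := exists_polynomialFunction d φ hφ hφ' Finset.univ q
      (fun i _ => ⟨M i, hM i⟩) γ
    refine ⟨p, hp, fun μ hμ => ?_⟩
    obtain ⟨n, rfl⟩ := (Submodule.mem_span_range_iff_exists_fun ℤ).1 hμ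
    exact hp' n

/-! ### Topes are open cones containing lattice points -/

theorem exists_ball_subset_topeAt [FiniteDimensional ℝ V] (L : List Γ) {W : Submodule ℝ V}
    {y : V} (hy : y ∈ topeComplement L W) :
    ∃ ε > 0, ∀ x ∈ W, dist x y < ε → x ∈ topeAt L W y := by
  set T : Set (Submodule ℝ V) := {t | t ∈ rationalSubspaces L ∧ t ≤ W ∧
    Module.finrank ℝ t + 1 = Module.finrank ℝ W} with hT
  have hTfin : T.Finite := (finite_rationalSubspaces L).subset fun t ht => ht.1
  have hclosed : IsClosed (⋃ t ∈ T, (t : Set V)) :=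
    hTfin.isClosed_biUnion fun t _ => t.closed_of_finiteDimensional
  have hyU : y ∈ (⋃ t ∈ T, (t : Set V))ᶜ := by
    simp only [Set.mem_compl_iff, Set.mem_iUnion, not_exists]
    exact fun t ht hyt => hy.2 t ht.1 ht.2.1 ht.2.2 hyt
  obtain ⟨ε, hε, hball⟩ := Metric.isOpen_iff.1 hclosed.isOpen_compl y hyU
  refine ⟨ε, hε, fun x hxW hx => ?_⟩
  have hconv : Convex ℝ (Metric.ball y ε ∩ (W : Set V)) :=
    (convex_ball y ε).inter W.convex
  refine hconv.isPreconnected.subset_connectedComponentIn ⟨Metric.mem_ball_self hε, hy.1⟩ ?_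
    ⟨hx, hxW⟩
  rintro z ⟨hz, hzW⟩
  refine ⟨hzW, fun t h1 h2 h3 hzt => hball hz ?_⟩
  simp only [Set.mem_iUnion]
  exact ⟨t, ⟨h1, h2, h3⟩, hzt⟩

theorem topeAt_eq {L : List Γ} {W : Submodule ℝ V} {x y : V} (hx : x ∈ topeAt L W y) :
    topeAt L W x = topeAt L W y :=
  (connectedComponentIn_eq hx).symm

theorem smul_mem_topeAt {L : List Γ} {W : Submodule ℝ V} {x y : V} (hx : x ∈ topeAt L W y)
    {c : ℝ} (hc : 0 < c) : c • x ∈ topeAt L W y := by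
  have hxS : x ∈ topeComplement L W := connectedComponentIn_subset _ _ hx
  rw [← topeAt_eq hx]
  have hpre : IsPreconnected ((fun s : ℝ => s • x) '' Set.Ioi 0) :=
    isPreconnected_Ioi.image _ (by fun_prop)
  refine hpre.subset_connectedComponentIn ⟨1, by simp, by simp⟩ ?_ ⟨c, hc, rfl⟩
  rintro _ ⟨s, hs, rfl⟩
  refine ⟨W.smul_mem _ hxS.1, fun t h1 h2 h3 hst => hxS.2 t h1 h2 h3 ?_⟩
  exact (t.smul_mem_iff (ne_of_gt hs)).1 hst

theorem exists_lattice_mem_topeAt [FiniteDimensional ℝ V] {L : List Γ} {W : Submodule ℝ V}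
    (hL : Submodule.span ℝ ((fun a : Γ => (a : V)) '' {a | a ∈ L}) = W) {y : V}
    (hy : y ∈ topeComplement L W) : ∃ δ : Γ, (δ : V) ∈ topeAt L W y := by
  obtain ⟨ε, hε, hball⟩ := exists_ball_subset_topeAt L hy
  have hyW := hy.1
  rw [← hL, Finsupp.mem_span_image_iff_linearCombination] at hyW
  obtain ⟨c, hc, rfl⟩ := hyW
  rw [Finsupp.mem_supported] at hc
  obtain ⟨n, hn⟩ := exists_nat_gt ((∑ a ∈ c.support, ‖(a : V)‖) / ε)
  have hn0 : (0 : ℝ) < n :=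
    lt_of_le_of_lt (div_nonneg (Finset.sum_nonneg fun _ _ => norm_nonneg _) hε.le) hn
  set δ : Γ := ∑ a ∈ c.support, ⌊n * c a⌋ • a with hδ
  have hδV : (δ : V) = ∑ a ∈ c.support, (⌊n * c a⌋ : ℝ) • (a : V) := by
    rw [hδ, AddSubmonoidClass.coe_finsetSum]
    exact Finset.sum_congr rfl fun a _ => by rw [Submodule.coe_smul, Int.cast_smul_eq_zsmul]
  refine ⟨δ, ?_⟩
  have h1 : (n : ℝ)⁻¹ • (δ : V) ∈ topeAt L W
      (Finsupp.linearCombination ℝ (fun a : Γ => (a : V)) c) := by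
    refine hball _ (W.smul_mem _ ?_) ?_
    · rw [hδV, ← hL]
      exact Submodule.sum_mem _ fun a ha =>
        Submodule.smul_mem _ _ (Submodule.subset_span ⟨a, hc ha, rfl⟩)
    · have h2 : (n : ℝ)⁻¹ • (δ : V) - Finsupp.linearCombination ℝ (fun a : Γ => (a : V)) c
          = -((n : ℝ)⁻¹ • ∑ a ∈ c.support, Int.fract (n * c a) • (a : V)) := by
        rw [hδV, Finsupp.linearCombination_apply, Finsupp.sum, Finset.smul_sum, Finset.smul_sum,
          ← Finset.sum_sub_distrib, ← Finset.sum_neg_distrib]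
        refine Finset.sum_congr rfl fun a _ => ?_
        rw [smul_smul, smul_smul, ← sub_smul, ← neg_smul, Int.fract]
        congr 1
        field_simp
        ring
      rw [dist_eq_norm, h2, norm_neg, norm_smul, norm_inv, Real.norm_natCast, inv_mul_lt_iff₀ hn0]
      rw [div_lt_iff₀ hε] at hn
      refine lt_of_le_of_lt ((norm_sum_le _ _).trans (Finset.sum_le_sum fun a _ => ?_)) hn
      rw [norm_smul, Real.norm_of_nonneg (Int.fract_nonneg _)]
      exact mul_le_of_le_one_left (norm_nonneg _) (Int.fract_lt_one _).le
  have h3 := smul_mem_topeAt h1 hn0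
  rwa [smul_smul, mul_inv_cancel₀ hn0.ne', one_smul] at h3

/-! ### Uniqueness of quasi-polynomials with given values on a tope -/

theorem exists_polynomial_eval_line {p : V → ℝ} (hp : p ∈ polynomialFunctions V) (x d : V) :
    ∃ P : Polynomial ℝ, ∀ s : ℝ, p (x + s • d) = P.eval s := by
  induction hp using Algebra.adjoin_induction with
  | mem p hp =>
    obtain ⟨φ, rfl⟩ := hp
    refine ⟨Polynomial.C (φ x) + Polynomial.X * Polynomial.C (φ d), fun s => ?_⟩
    simp only [map_add, map_smul, smul_eq_mul, Polynomial.eval_add, Polynomial.eval_mul,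
      Polynomial.eval_C, Polynomial.eval_X]
  | algebraMap r => exact ⟨Polynomial.C r, fun s => by simp⟩
  | add p q _ _ hp hq =>
    obtain ⟨P, hP⟩ := hp
    obtain ⟨Q, hQ⟩ := hq
    exact ⟨P + Q, fun s => by simp [hP, hQ]⟩
  | mul p q _ _ hp hq =>
    obtain ⟨P, hP⟩ := hp
    obtain ⟨Q, hQ⟩ := hq
    exact ⟨P * Q, fun s => by simp [hP, hQ]⟩

theorem IsQuasiPolynomial.exists_eval_ray {W : Submodule ℝ V} {q : Γ → ℤ}
    (hq : IsQuasiPolynomial W q) :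
    ∃ N : ℕ, 0 < N ∧ ∀ M : ℕ, N ∣ M → ∀ γ δ : Γ, (γ : V) ∈ W → (δ : V) ∈ W →
      ∃ P : Polynomial ℝ, ∀ k : ℕ, (q (γ + k • M • δ) : ℝ) = P.eval (k : ℝ) := by
  obtain ⟨-, Λ, hΛ, hidx, hpoly⟩ := hq
  refine ⟨Λ.relIndex (latticeIn Γ W), Nat.pos_of_ne_zero hidx, ?_⟩
  rintro _ ⟨M, rfl⟩ γ δ hγ hδ
  obtain ⟨p, hp, hp'⟩ := hpoly γ hγ
  have hmem : (Λ.relIndex (latticeIn Γ W) * M) • δ ∈ Λ := by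
    rw [mul_comm, mul_smul]
    refine Λ.nsmul_mem ?_ M
    exact AddSubgroup.nsmul_index_mem (Λ.addSubgroupOf (latticeIn Γ W)) ⟨δ, hδ⟩
  obtain ⟨P, hP⟩ := exists_polynomial_eval_line hp (γ : V)
    (((Λ.relIndex (latticeIn Γ W) * M) • δ : Γ) : V)
  refine ⟨P, fun k => ?_⟩
  rw [hp' _ (Λ.nsmul_mem hmem k), ← hP, Submodule.coe_add, coe_nsmul_real k]

theorem IsQuasiPolynomial.eq_of_eqOn_topeAt [FiniteDimensional ℝ V] {L : List Γ}
    {W : Submodule ℝ V}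
    (hL : Submodule.span ℝ ((fun a : Γ => (a : V)) '' {a | a ∈ L}) = W) {y : V}
    (hy : y ∈ topeComplement L W) {q₁ q₂ : Γ → ℤ} (h₁ : IsQuasiPolynomial W q₁)
    (h₂ : IsQuasiPolynomial W q₂) (h : ∀ γ : Γ, (γ : V) ∈ topeAt L W y → q₁ γ = q₂ γ) :
    q₁ = q₂ := by
  funext γ
  by_cases hγ : (γ : V) ∈ W
  swap
  · rw [h₁.1 γ hγ, h₂.1 γ hγ]
  obtain ⟨δ, hδ⟩ := exists_lattice_mem_topeAt hL hy
  have hδS : (δ : V) ∈ topeComplement L W := connectedComponentIn_subset _ _ hδ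
  obtain ⟨N₁, hN₁, H₁⟩ := h₁.exists_eval_ray
  obtain ⟨N₂, hN₂, H₂⟩ := h₂.exists_eval_ray
  obtain ⟨P₁, hP₁⟩ := H₁ (N₁ * N₂) (dvd_mul_right _ _) γ δ hγ hδS.1
  obtain ⟨P₂, hP₂⟩ := H₂ (N₁ * N₂) (dvd_mul_left _ _) γ δ hγ hδS.1
  have hδ' : (((N₁ * N₂) • δ : Γ) : V) ∈ topeAt L W y := by
    rw [coe_nsmul_real]
    exact smul_mem_topeAt hδ (by exact_mod_cast Nat.mul_pos hN₁ hN₂)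
  set η := (N₁ * N₂) • δ
  obtain ⟨ε, hε, hball⟩ := exists_ball_subset_topeAt L (connectedComponentIn_subset _ _ hδ')
  obtain ⟨n, hn⟩ := exists_nat_gt (‖(γ : V)‖ / ε)
  have hlarge : ∀ k : ℕ, n ≤ k → P₁.eval (k : ℝ) = P₂.eval (k : ℝ) := by
    intro k hk
    have hk' : ‖(γ : V)‖ / ε < k := hn.trans_le (by exact_mod_cast hk)
    have hk0 : (0 : ℝ) < k := lt_of_le_of_lt (div_nonneg (norm_nonneg _) hε.le) hk'
    rw [← hP₁, ← hP₂, h]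
    have h1 : (η : V) + (k : ℝ)⁻¹ • (γ : V) ∈ topeAt L W y := by
      rw [← topeAt_eq hδ']
      refine hball _ (W.add_mem (connectedComponentIn_subset _ _ hδ').1 (W.smul_mem _ hγ)) ?_
      rw [dist_eq_norm, add_sub_cancel_left, norm_smul, norm_inv, Real.norm_natCast,
        inv_mul_lt_iff₀ hk0]
      rwa [div_lt_iff₀ hε] at hk'
    have h2 := smul_mem_topeAt h1 hk0
    rwa [smul_add, smul_smul, mul_inv_cancel₀ hk0.ne', one_smul, add_comm, ← coe_nsmul_real,
      ← Submodule.coe_add] at h2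
  have hPP : P₁ = P₂ := by
    refine Polynomial.eq_of_infinite_eval_eq _ _ (Set.Infinite.mono ?_
      ((Set.Ici_infinite n).image (Nat.cast_injective (R := ℝ)).injOn))
    rintro _ ⟨k, hk, rfl⟩
    exact hlarge k hk
  have h0 := hP₁ 0
  have h0' := hP₂ 0
  rw [zero_smul, add_zero] at h0 h0'
  rw [hPP, ← h0'] at h0
  exact_mod_cast h0

/-! ### The decomposition of `F(X)` -/

open scoped Pointwise in
theorem isPositiveFor_neg_regularFace {X : List Γ} {r : Submodule ℝ V} {w : V}
    (hw : w ∈ regularVectors X r) :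
    IsPositiveFor (-(regularFace X r w)) (-w) (outside X r) := by
  intro a ha
  have hwF : -w ∈ -(regularFace X r w) := by
    rw [Set.mem_neg, neg_neg]
    exact mem_connectedComponentIn hw
  unfold posDir
  split_ifs with h
  · exact h _ hwF
  · have hne := hw.2 a ha
    rw [NegMemClass.coe_neg, inner_neg_neg]
    by_contra h0
    have hlt : inner ℝ w (a : V) < 0 := lt_of_le_of_ne (not_lt.1 h0) hne
    refine h fun v hv => ?_
    have := mul_pos_of_mem_connectedComponentIn (φ := fun z => inner ℝ z (a : V))
      (by fun_prop) (fun z hz => hz.2 a ha) hw (Set.mem_neg.1 hv)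
    have h1 := neg_of_mul_pos_left this hlt.le
    simpa [inner_neg_left] using h1

theorem mem_rationalFinset {X : List Γ} {r : Submodule ℝ V} :
    r ∈ rationalFinset X ↔ r ∈ rationalSubspaces X :=
  Set.Finite.mem_toFinset _

variable [FiniteDimensional ℝ V]

theorem neg_mem_orthogonal_of_isGeneric {X : List Γ} {r : Submodule ℝ V} {β : V}
    (h : IsGeneric X r β) : -(rᗮ.starProjection β) ∈ rᗮ :=
  neg_mem h.2.1

theorem convDefined_negPartitionFn {X : List Γ} {r : Submodule ℝ V} {β : V}
    (h : IsGeneric X r β) {q : Γ → ℤ} (hq : SupportedOn r q) :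
    ConvDefined (negPartitionFn X r β) q :=
  convDefined_partitionFn (isPositiveFor_neg_regularFace h.2) (neg_mem_orthogonal_of_isGeneric h) hq

theorem nablaList_conv_negPartitionFn_self {X : List Γ} {r : Submodule ℝ V} {β : V}
    (h : IsGeneric X r β) {q : Γ → ℤ} (hq : SupportedOn r q) :
    nablaList (outside X r) (conv (negPartitionFn X r β) q) = q :=
  nablaList_conv_partitionFn (isPositiveFor_neg_regularFace h.2)
    (neg_mem_orthogonal_of_isGeneric h) hq

theorem nablaList_conv_negPartitionFn_of_not_le {X : List Γ} {t r : Submodule ℝ V} {β : V}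
    (h : IsGeneric X t β) {q : Γ → ℤ} (hq : q ∈ DM (inside X t) t) (htr : ¬ t ≤ r) :
    nablaList (outside X r) (conv (negPartitionFn X t β) q) = 0 :=
  nablaList_conv_of_not_le (isPositiveFor_neg_regularFace h.2)
    (neg_mem_orthogonal_of_isGeneric h) hq htr

theorem conv_negPartitionFn_mem_FSpace {X : List Γ} {t : Submodule ℝ V} {β : V}
    (h : IsGeneric X t β) {q : Γ → ℤ} (hq : q ∈ DM (inside X t) t) :
    conv (negPartitionFn X t β) q ∈ FSpace X := by
  intro r _
  by_cases htr : t ≤ r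
  · have := nablaList_conv_of_le (isPositiveFor_neg_regularFace h.2)
      (neg_mem_orthogonal_of_isGeneric h) hq.1 htr
    unfold negPartitionFn
    rw [this]
    refine supportedOn_conv_partitionFn (fun a ha => ?_) hq.1 htr
    exact (mem_inside.1 (mem_outside.1 ha).1).2
  · rw [nablaList_conv_negPartitionFn_of_not_le h hq htr]
    exact fun _ _ => rfl

theorem FSpace_sub {X : List Γ} {f g : Γ → ℤ} (hf : f ∈ FSpace X) (hg : g ∈ FSpace X) :
    f - g ∈ FSpace X := fun r hr γ hγ => by
  rw [nablaList_sub, Pi.sub_apply, hf r hr γ hγ, hg r hr γ hγ, sub_zero]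

theorem FSpace_sum {ι : Type*} {X : List Γ} (s : Finset ι) {f : ι → Γ → ℤ}
    (hf : ∀ i ∈ s, f i ∈ FSpace X) : ∑ i ∈ s, f i ∈ FSpace X := fun r hr γ hγ => by
  rw [nablaList_sum, Finset.sum_apply]
  exact Finset.sum_eq_zero fun i hi => hf i hi r hr γ hγ

theorem exists_decomposition_of_finrank_lt {X : List Γ} {β : V}
    (hX : (⊤ : Submodule ℝ V) ∈ rationalSubspaces X)
    (hβ : ∀ r ∈ rationalSubspaces X, IsGeneric X r β) (k i : ℕ)
    (hki : Module.finrank ℝ V + 1 ≤ i + k) {f : Γ → ℤ} (hf : f ∈ FSpace X)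
    (hfi : ∀ r ∈ rationalSubspaces X, Module.finrank ℝ r < i → nablaList (outside X r) f = 0) :
    ∃ q : Submodule ℝ V → Γ → ℤ, (∀ r ∈ rationalSubspaces X, q r ∈ DM (inside X r) r) ∧
      f = ∑ r ∈ rationalFinset X, conv (negPartitionFn X r β) (q r) := by
  induction k generalizing i f with
  | zero =>
    have h := hfi ⊤ hX (by rw [finrank_top]; omega)
    have h1 : outside X (⊤ : Submodule ℝ V) = [] := by simp [outside]
    rw [h1] at h
    have h2 : f = 0 := h
    exact ⟨0, fun r _ => zero_mem_DM _ _, by simp [h2, conv_zero]⟩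
  | succ k ih =>
    set p : Submodule ℝ V → Γ → ℤ := fun r =>
      if Module.finrank ℝ r = i then nablaList (outside X r) f else 0 with hp
    have hpDM : ∀ r ∈ rationalSubspaces X, p r ∈ DM (inside X r) r := by
      intro r hr
      by_cases hri : Module.finrank ℝ r = i
      · have e : p r = nablaList (outside X r) f := if_pos hri
        rw [e]
        refine ⟨hf r hr, fun t ht htr => ?_⟩
        obtain ⟨htX, hle⟩ := mem_rationalSubspaces_inside.1 ht
        rw [← nablaList_append, ← nablaList_perm (outside_perm_of_le X hle)]
        exact hfi t htX (hri ▸ Submodule.finrank_lt_finrank_of_lt (lt_of_le_of_ne hle htr))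
      · have e : p r = 0 := if_neg hri
        rw [e]
        exact zero_mem_DM _ _
    set g := ∑ r ∈ rationalFinset X, conv (negPartitionFn X r β) (p r) with hg
    have hgF : g ∈ FSpace X := FSpace_sum _ fun r hr =>
      conv_negPartitionFn_mem_FSpace (hβ r (mem_rationalFinset.1 hr))
        (hpDM r (mem_rationalFinset.1 hr))
    have hterm : ∀ r ∈ rationalSubspaces X, Module.finrank ℝ r ≤ i →
        nablaList (outside X r) g = p r := by
      intro r hr hri
      rw [hg, nablaList_sum, Finset.sum_eq_single r]
      · exact nablaList_conv_negPartitionFn_self (hβ r hr) (hpDM r hr).1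
      · intro t ht htr
        have htX := mem_rationalFinset.1 ht
        by_cases hle : t ≤ r
        · have hlt := Submodule.finrank_lt_finrank_of_lt (lt_of_le_of_ne hle htr)
          have e : p t = 0 := if_neg (by omega)
          rw [e, conv_zero, nablaList_zero]
        · exact nablaList_conv_negPartitionFn_of_not_le (hβ t htX) (hpDM t htX) hle
      · exact fun h => absurd (mem_rationalFinset.2 hr) h
    obtain ⟨q, hq, hq'⟩ := ih (i + 1) (by omega) (FSpace_sub hf hgF) (fun r hr hri => by
      rw [nablaList_sub, hterm r hr (by omega)]
      by_cases h : Module.finrank ℝ r = i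
      · have e : p r = nablaList (outside X r) f := if_pos h
        rw [e, sub_self]
      · have e : p r = 0 := if_neg h
        rw [e, hfi r hr (by omega), sub_self])
    refine ⟨fun r => q r + p r, fun r hr => add_mem_DM (hq r hr) (hpDM r hr), ?_⟩
    rw [sub_eq_iff_eq_add.1 hq', hg, ← Finset.sum_add_distrib]
    refine Finset.sum_congr rfl fun r hr => ?_
    have hr' := mem_rationalFinset.1 hr
    exact (conv_add (convDefined_negPartitionFn (hβ r hr') (hq r hr').1)
      (convDefined_negPartitionFn (hβ r hr') (hpDM r hr').1)).symm

/-! ### Locating the components on topes -/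

theorem inner_starProjection_orthogonal_nonneg {t r : Submodule ℝ V} (h : t ≤ r) (β : V) :
    0 ≤ inner ℝ (tᗮ.starProjection β) (r.starProjection β) := by
  set y := r.starProjection β with hy
  have hz : β - y ∈ rᗮ := r.sub_starProjection_mem_orthogonal β
  have hzt : β - y ∈ tᗮ := Submodule.orthogonal_le h hz
  have h1 : tᗮ.starProjection β = tᗮ.starProjection y + (β - y) := by
    conv_lhs => rw [← add_sub_cancel y β]
    rw [map_add, Submodule.starProjection_eq_self_iff.2 hzt]
  have h2 : inner ℝ (β - y) y = 0 :=
    (Submodule.mem_orthogonal' r _).1 hz y (r.starProjection_apply_mem β)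
  rw [h1, inner_add_left, h2, add_zero]
  have := Submodule.re_inner_starProjection_nonneg tᗮ y
  simpa using this

theorem mem_topeComplement_of_isGeneric {X : List Γ} {r : Submodule ℝ V} {β : V}
    (h : IsGeneric X r β) : r.starProjection β ∈ topeComplement (inside X r) r := by
  obtain ⟨⟨τ, ⟨x, -, rfl⟩, hτ⟩, -⟩ := h
  exact connectedComponentIn_subset _ _ hτ

theorem isTopeQuasiPolynomial_of_decomposition [DiscreteTopology Γ] [IsZLattice ℝ Γ]
    {X : List Γ} {β : V} (hβ : ∀ r ∈ rationalSubspaces X, IsGeneric X r β) {f : Γ → ℤ}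
    {q : Submodule ℝ V → Γ → ℤ} (hq : ∀ r ∈ rationalSubspaces X, q r ∈ DM (inside X r) r)
    (hf : f = ∑ r ∈ rationalFinset X, conv (negPartitionFn X r β) (q r)) {r : Submodule ℝ V}
    (hr : r ∈ rationalSubspaces X) :
    IsTopeQuasiPolynomial (inside X r) r (nablaList (outside X r) f)
      (topeAt (inside X r) r (r.starProjection β)) (q r) := by
  have hspan := span_inside hr
  refine ⟨isQuasiPolynomial_of_mem_DM hspan (hq r hr), fun γ hγ => ?_⟩
  rw [hf, nablaList_sum, Finset.sum_apply, Finset.sum_eq_single r]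
  · rw [nablaList_conv_negPartitionFn_self (hβ r hr) (hq r hr).1]
  · intro t ht htr
    have htX := mem_rationalFinset.1 ht
    by_cases hle : t ≤ r
    · have hpos := isPositiveFor_neg_regularFace (hβ t htX).2
      have hort := neg_mem_orthogonal_of_isGeneric (hβ t htX)
      unfold negPartitionFn
      rw [nablaList_conv_of_le hpos hort (hq t htX).1 hle]
      refine conv_partitionFn_eq_zero hspan (mem_rationalSubspaces_inside.2 ⟨htX, hle⟩) htr hort
        (hpos.mono fun a ha => ?_) (hq t htX).1 (mem_topeComplement_of_isGeneric (hβ r hr)) ?_ hγ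
      · rw [mem_outside, mem_inside] at ha
        exact mem_outside.2 ⟨ha.1.1, ha.2⟩
      · rw [inner_neg_left, neg_nonpos]
        exact inner_starProjection_orthogonal_nonneg hle β
    · rw [nablaList_conv_negPartitionFn_of_not_le (hβ t htX) (hq t htX) hle, Pi.zero_apply]
  · exact fun h => absurd (mem_rationalFinset.2 hr) h

theorem IsTopeQuasiPolynomial.unique {X : List Γ} {r : Submodule ℝ V}
    (hr : r ∈ rationalSubspaces X) {y : V} (hy : y ∈ topeComplement (inside X r) r)
    {g q₁ q₂ : Γ → ℤ}
    (h₁ : IsTopeQuasiPolynomial (inside X r) r g (topeAt (inside X r) r y) q₁)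
    (h₂ : IsTopeQuasiPolynomial (inside X r) r g (topeAt (inside X r) r y) q₂) : q₁ = q₂ := by
  refine h₁.1.eq_of_eqOn_topeAt (span_inside hr) hy h₂.1 fun γ hγ => ?_
  have h : ∃ x ∈ topeAt (inside X r) r y, ∃ b ∈ zonotope (inside X r), (γ : V) = x - b :=
    ⟨γ, hγ, 0, zero_mem_zonotope _, by simp⟩
  rw [h₁.2 γ h, h₂.2 γ h]

end LatticeSplines

open LatticeSplines
theorem theorem3p9 {V : Type*} [NormedAddCommGroup V] [InnerProductSpace ℝ V]
    [FiniteDimensional ℝ V] (Γ : Submodule ℤ V) [DiscreteTopology Γ] [IsZLattice ℝ Γ]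
    (X : List Γ) (hX0 : ∀ a ∈ X, a ≠ 0)
    (hXspan : Submodule.span ℝ ((fun a : Γ => (a : V)) '' {a | a ∈ X}) = ⊤)
    (β : V) (hβ : ∀ r ∈ rationalSubspaces X, IsGeneric X r β)
    (f : Γ → ℤ) (hf : f ∈ FSpace X) :
    -- each `(∇_{X \ r} f)^{τ(p_r β)}` is well defined, and it lies in `DM(X ∩ r)`
    (∀ r ∈ rationalSubspaces X,
      (∃! q : Γ → ℤ, IsTopeQuasiPolynomial (inside X r) r (nablaList (outside X r) f)
        (topeAt (inside X r) r (r.starProjection β)) q) ∧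
      localQuasiPolynomial X r β f ∈ DM (inside X r) r) ∧
    -- the convolutions are well defined
    (∀ r ∈ rationalSubspaces X, ∀ q ∈ DM (inside X r) r,
      ConvDefined (negPartitionFn X r β) q) ∧
    -- the formula
    f = ∑ r ∈ rationalFinset X, conv (negPartitionFn X r β) (localQuasiPolynomial X r β f) ∧
    -- it is the only expression of `f` as a sum of elements of the components
    -- `P_{X \ r}^{-F} * DM(X ∩ r)`
    (∀ q : Submodule ℝ V → Γ → ℤ,
      (∀ r ∈ rationalSubspaces X, q r ∈ DM (inside X r) r) →
      f = ∑ r ∈ rationalFinset X, conv (negPartitionFn X r β) (q r) →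
      ∀ r ∈ rationalSubspaces X, q r = localQuasiPolynomial X r β f) := by
  have key : ∀ q : Submodule ℝ V → Γ → ℤ,
      (∀ r ∈ rationalSubspaces X, q r ∈ DM (inside X r) r) →
      f = ∑ r ∈ rationalFinset X, conv (negPartitionFn X r β) (q r) →
      ∀ r ∈ rationalSubspaces X, q r = localQuasiPolynomial X r β f := by
    intro q hq hfq r hr
    have h := isTopeQuasiPolynomial_of_decomposition hβ hq hfq hr
    exact h.unique hr (mem_topeComplement_of_isGeneric (hβ r hr))
      (Classical.epsilon_spec_aux ⟨q r⟩ _ ⟨q r, h⟩)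
  obtain ⟨q, hq, hfq⟩ := exists_decomposition_of_finrank_lt (β := β) ⟨_, Set.Subset.rfl, hXspan⟩ hβ
    (Module.finrank ℝ V + 1) 0 (by omega) hf (fun r _ h => absurd h (Nat.not_lt_zero _))
  refine ⟨fun r hr => ⟨⟨q r, ?_, fun q' hq' => ?_⟩, ?_⟩,
    fun r hr p hp => convDefined_negPartitionFn (hβ r hr) hp.1, ?_, key⟩
  · exact isTopeQuasiPolynomial_of_decomposition hβ hq hfq hr
  · exact IsTopeQuasiPolynomial.unique hr (mem_topeComplement_of_isGeneric (hβ r hr)) hq'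
      (isTopeQuasiPolynomial_of_decomposition hβ hq hfq hr)
  · rw [← key q hq hfq r hr]
    exact hq r hr
  · conv_lhs => rw [hfq]
    exact Finset.sum_congr rfl fun r hr => by rw [key q hq hfq r (mem_rationalFinset.1 hr)]
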